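/- A convex polyhedron is a compact intersection of finitely many closed half-spaces of $\mathbb{R}^3$. It is called semiregular if it is three-dimensional, all its 2-faces are regular polygons, and its symmetry group acts transitively on its vertices (so the Platonic solids, the prisms and antiprisms with regular faces, and the Archimedean solids are semiregular). For such a polyhedron $Q$ let $V(Q)$ be its vertex set, $f_i(Q)$ its number of $i$-dimensional faces, and $R_1[Q]$ its rectification, the convex hull of the midpoints of the edges of $Q$. Put $R_0[P]=P$ and $R_{i+1}[P]=R_1[R_i[P]]$. For $v\in V(Q)$ let $Q/v$ be the vertex figure truncated to half the edge length, that is, the convex hull of the midpoints of the edges of $Q$ containing $v$. Theorem 4. Let $k\ge 1$ and let $P\to R_1[P]\to\cdots\to R_{k-1}[P]$ be a rectification sequence all of whose members $R_0[P],\dots,R_{k-1}[P]$ are semiregular. Then $$\bigl(f_0(R_k[P]),f_1(R_k[P]),f_2(R_k[P])\bigr)=\bigl(2^{k-1}f_1(P),\;2^{k}f_1(P),\;2+2^{k-1}f_1(P)\bigr)$$ and $$\operatorname{vol}(R_k[P])=\operatorname{vol}(P)-\sum_{v\in V(P)}\operatorname{vol}\bigl(\operatorname{conv}(P/v\cup\{v\})\bigr)-\sum_{N=1}^{k-1}\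 \sum_{v\in V(R_N[P])}\operatorname{vol}\bigl(\operatorname{conv}(R_N[P]/v\cup\{v\})\bigr).$$ -/

import Mathlib

open scoped EuclideanGeometry

noncomputable section

namespace Rectification

/-- Euclidean three-space. -/
abbrev E3 : Type := EuclideanSpace ℝ (Fin 3)

/-- A compact intersection of finitely many closed half-spaces of `ℝ³`
(possibly of dimension less than three). -/
def IsConvexPolyhedron (P : Set E3) : Prop :=
  IsCompact P ∧ ∃ H : Set (E3 × ℝ), H.Finite ∧ (∀ h ∈ H, h.1 ≠ 0) ∧
    P = {x | ∀ h ∈ H, inner ℝ h.1 x ≤ h.2}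

/-- The nonempty faces of `P` of dimension `i`: the nonempty sets of maximizers over `P` of a
linear functional, whose affine hull has dimension `i`. -/
def faces (P : Set E3) (i : ℕ) : Set (Set E3) :=
  {F | F.Nonempty ∧ IsExposed ℝ P F ∧ Module.finrank ℝ (vectorSpan ℝ F) = i}

/-- `f_i(P)`, the number of `i`-dimensional faces. -/
def fNumber (P : Set E3) (i : ℕ) : ℕ := (faces P i).ncard

/-- The vertex set `V(P)`. -/
def vertices (P : Set E3) : Set E3 := {v | {v} ∈ faces P 0}

/-- The graph `G_P` of `P`: `v` and `w` are adjacent when the segment `[v, w]` is an edge of `P`. -/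
def graph (P : Set E3) : SimpleGraph E3 where
  Adj v w := segment ℝ v w ∈ faces P 1
  symm := ⟨fun v w h => by
    rw [segment_symm]
    exact h⟩
  loopless := ⟨fun v h => by
    have h1 := h.2.2
    rw [segment_same, vectorSpan_singleton, finrank_bot] at h1
    exact zero_ne_one h1⟩

/-- The rectification `R₁[P]`: the convex hull of the midpoints of the edges of `P`. -/
def rectify (P : Set E3) : Set E3 :=
  convexHull ℝ {m | ∃ v w, (graph P).Adj v w ∧ m = midpoint ℝ v w}

/-- The `k`-th rectification `R_k[P]`, with `R₀[P] = P`. -/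
def R (k : ℕ) (P : Set E3) : Set E3 := rectify^[k] P

/-- A regular polygon in `ℝ³`: a two-dimensional convex polygon all of whose sides have the same
length and all of whose interior angles are equal. -/
structure IsRegularPolygon (F : Set E3) : Prop where
  polygon : IsConvexPolyhedron F
  dim_eq : Module.finrank ℝ (vectorSpan ℝ F) = 2
  equilateral : ∀ v w v' w', (graph F).Adj v w → (graph F).Adj v' w' → dist v w = dist v' w'
  equiangular : ∀ u v w u' v' w',
    (graph F).Adj v u → (graph F).Adj v w → u ≠ w →
    (graph F).Adj v' u' → (graph F).Adj v' w' → u' ≠ w' → ∠ u v w = ∠ u' v' w'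

/-- A semiregular polyhedron: a three-dimensional convex polyhedron whose facets are regular
polygons and whose symmetry group is transitive on the vertices. -/
structure IsSemiregular (P : Set E3) : Prop where
  polyhedron : IsConvexPolyhedron P
  dim_eq : Module.finrank ℝ (vectorSpan ℝ P) = 3
  regular_faces : ∀ F ∈ faces P 2, IsRegularPolygon F
  vertex_transitive : ∀ v ∈ vertices P, ∀ w ∈ vertices P,
    ∃ φ : E3 ≃ᵃⁱ[ℝ] E3, φ '' P = P ∧ φ v = w

/-- The vertex figure `P / v` truncated to half the edge length: the convex hull of the midpoints
of the edges of `P` that contain `v`. -/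
def vertexFigure (P : Set E3) (v : E3) : Set E3 :=
  convexHull ℝ {m | ∃ w, (graph P).Adj v w ∧ m = midpoint ℝ v w}

/-- The cone `conv((P / v) ∪ {v})` that is cut off at the vertex `v`. -/
def vertexCone (P : Set E3) (v : E3) : Set E3 :=
  convexHull ℝ (vertexFigure P v ∪ {v})

/-- Three-dimensional volume. -/
def vol (S : Set E3) : ℝ := MeasureTheory.volume.real S

end Rectification

end

/-! Semiregularity enters only through a metric consequence: there are a center `c` in the interior
and numbers `r`, `l` such that all vertices are at distance `r` from `c` and all edges have length
`l` (`IsSemiregular.exists_isInscribedEquilateral`). Transitivity gives the common radius about the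
centroid; regular facets and connectedness of the graph give the common length.

For such a polyhedron the law of cosines makes `⟪v - c, w - c⟫` the same for all adjacent `v`, `w`.
So the neighbours of `v` span a section orthogonal to `v - c`, and halfway up, the midpoints of the
edges at `v` lie in the plane `⟪v - c, x - c⟫ = r ^ 2 - l ^ 2 / 4`. Since `P` lies in the cone
spanned at `v` by its edges (`mem_cone_of_mem`), rectifying `P` is the same as truncating it by
these planes (`rectify_eq`), and the piece beyond the plane is exactly `vertexCone P v`
(`vertexCone_eq`). The pieces overlap only in null sets, which gives the volume formula for one step
(`vol_rectify`).

The truncation also gives the faces of the rectification. Its vertices are the edge midpoints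
(`vertices_rectify`). Each of its facets comes from a vertex or from a facet of `P`, and each of its
edges is the intersection of one of either kind, so that edges correspond to incident pairs of a
vertex and a facet (`bijOn_flagEdge`). Double counting gives `2 * fNumber P 1` such pairs, and
Euler's formula gives the number of facets. Iteration over the sequence finishes the proof.

The polyhedral facts used (two facets at an edge, connectedness, Euler's formula) all come from one
correspondence between the faces of a hyperplane section and the faces of `P` (`bijOn_slice`).
Cutting off a vertex gives local incidences; sweeping a generic plane upwards gives Euler's formula.
-/

noncomputable section

namespace Rectification

/-! ### Minimal faces and the face lattice. -/

/-- The smallest face of the convex set `P` that contains `x`. -/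
def minFace (P : Set E3) (x : E3) : Set E3 :=
  {y | y ∈ P ∧ ∃ ε > (0 : ℝ), x + ε • (x - y) ∈ P}

theorem minFace_subset {P : Set E3} {x : E3} : minFace P x ⊆ P := fun _ hy => hy.1

theorem self_mem_minFace {P : Set E3} {x : E3} (hx : x ∈ P) : x ∈ minFace P x :=
  ⟨hx, 1, one_pos, by simpa⟩

theorem add_smul_mem_of_le {P : Set E3} {x y : E3} {ε δ : ℝ} (hP : Convex ℝ P) (hx : x ∈ P)
    (hδ : 0 ≤ δ) (hδε : δ ≤ ε) (hy : x + ε • y ∈ P) : x + δ • y ∈ P := by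
  rcases hδ.eq_or_lt with rfl | h
  · simpa
  · have hε : 0 < ε := h.trans_le hδε
    have := hP.add_smul_mem hx hy (t := δ / ε) ⟨by positivity, (div_le_one hε).2 hδε⟩
    rwa [smul_smul, div_mul_cancel₀ _ hε.ne'] at this

/-- The point `x` is relatively interior to its minimal face, so the directions of that face are
those in which one can move both ways. This turns dimension questions into membership questions. -/
theorem mem_vectorSpan_minFace {P : Set E3} {x y : E3} (hP : Convex ℝ P) (hx : x ∈ P) :
    y ∈ vectorSpan ℝ (minFace P x) ↔ ∃ ε > (0 : ℝ), x + ε • y ∈ P ∧ x - ε • y ∈ P := by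
  rw [vectorSpan_eq_span_vsub_set_right ℝ (self_mem_minFace hx)]
  constructor
  · intro hy
    induction hy using Submodule.span_induction with
    | mem y hy =>
      obtain ⟨z, ⟨hz, ε, hε, hz'⟩, rfl⟩ := hy
      refine ⟨min 1 ε, by positivity, ?_, ?_⟩
      · exact add_smul_mem_of_le hP hx (by positivity) (min_le_left _ _) (by simpa using hz)
      · have := add_smul_mem_of_le hP hx (by positivity) (min_le_right 1 ε) hz'
        convert this using 1
        simp only [vsub_eq_sub]
        module
    | zero => exact ⟨1, one_pos, by simpa, by simpa⟩
    | add y z _ _ hy hz =>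
      obtain ⟨ε, hε, h1, h2⟩ := hy
      obtain ⟨δ, hδ, h3, h4⟩ := hz
      rw [sub_eq_add_neg, ← smul_neg] at h2 h4
      have hm : 0 < min ε δ := lt_min hε hδ
      have a1 := add_smul_mem_of_le hP hx hm.le (min_le_left ε δ) h1
      have a2 := add_smul_mem_of_le hP hx hm.le (min_le_left ε δ) h2
      have a3 := add_smul_mem_of_le hP hx hm.le (min_le_right ε δ) h3
      have a4 := add_smul_mem_of_le hP hx hm.le (min_le_right ε δ) h4
      refine ⟨min ε δ / 2, by positivity, ?_, ?_⟩
      · convert hP a1 a3 (a := 1 / 2) (b := 1 / 2) (by norm_num) (by norm_num) (by norm_num) using 1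
        module
      · convert hP a2 a4 (a := 1 / 2) (b := 1 / 2) (by norm_num) (by norm_num) (by norm_num) using 1
        module
    | smul a y _ hy =>
      obtain ⟨ε, hε, h1, h2⟩ := hy
      rcases lt_trichotomy a 0 with ha | rfl | ha
      · refine ⟨ε / -a, div_pos hε (neg_pos.2 ha), ?_, ?_⟩
        · convert h2 using 1
          rw [smul_smul, show ε / -a * a = -ε by rw [div_neg, neg_mul, div_mul_cancel₀ _ ha.ne]]
          module
        · convert h1 using 1
          rw [smul_smul, show ε / -a * a = -ε by rw [div_neg, neg_mul, div_mul_cancel₀ _ ha.ne]]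
          module
      · exact ⟨1, one_pos, by simpa, by simpa⟩
      · refine ⟨ε / a, div_pos hε ha, ?_, ?_⟩
        · convert h1 using 1
          rw [smul_smul, div_mul_cancel₀ _ ha.ne']
        · convert h2 using 1
          rw [smul_smul, div_mul_cancel₀ _ ha.ne']
  · rintro ⟨ε, hε, h1, h2⟩
    have : ε • y ∈ Submodule.span ℝ ((fun z => z -ᵥ x) '' minFace P x) := by
      refine Submodule.subset_span ⟨x + ε • y, ⟨h1, 1, one_pos, ?_⟩, by simp⟩
      convert h2 using 1
      module
    have h := Submodule.smul_mem _ ε⁻¹ this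
    rwa [smul_smul, inv_mul_cancel₀ hε.ne', one_smul] at h

theorem exists_inner_of_isExposed {P F : Set E3} (hF : F.Nonempty) (h : IsExposed ℝ P F) :
    ∃ (g : E3) (b : ℝ), (∀ y ∈ P, inner ℝ g y ≤ b) ∧ F = {x ∈ P | inner ℝ g x = b} := by
  obtain ⟨l, rfl⟩ := h hF
  obtain ⟨w, hw, hw'⟩ := hF
  refine ⟨(InnerProductSpace.toDual ℝ E3).symm l, l w, ?_, ?_⟩
  · simpa using hw'
  · ext x
    simp only [InnerProductSpace.toDual_symm_apply, Set.mem_ofPred_eq, and_congr_right_iff]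
    exact fun hx => ⟨fun h => le_antisymm (hw' x hx) (h w hw), fun h y hy => h ▸ hw' y hy⟩

theorem isExposed_of_inner {P : Set E3} {g : E3} {b : ℝ} (h : ∀ y ∈ P, inner ℝ g y ≤ b) :
    IsExposed ℝ P {x ∈ P | inner ℝ g x = b} := by
  rintro ⟨w, hw, hw'⟩
  refine ⟨InnerProductSpace.toDual ℝ E3 g, ?_⟩
  ext x
  simp only [InnerProductSpace.toDual_apply_apply, Set.mem_ofPred_eq, and_congr_right_iff]
  exact fun hx => ⟨fun e y hy => e ▸ h y hy, fun h' => le_antisymm (h x hx) (hw' ▸ h' w hw)⟩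

theorem minFace_subset_of_isExposed {P F : Set E3} {x : E3} (h : IsExposed ℝ P F) (hx : x ∈ F) :
    minFace P x ⊆ F := by
  obtain ⟨g, b, hb, rfl⟩ := exists_inner_of_isExposed ⟨x, hx⟩ h
  rintro y ⟨hy, ε, hε, hy'⟩
  refine ⟨hy, le_antisymm (hb y hy) ?_⟩
  have := hb _ hy'
  rw [inner_add_right, inner_smul_right, inner_sub_right, hx.2] at this
  nlinarith

theorem IsConvexPolyhedron.convex {P : Set E3} (hP : IsConvexPolyhedron P) : Convex ℝ P := by
  obtain ⟨-, H, -, -, rfl⟩ := hP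
  intro x hx y hy a b ha hb hab h hh
  rw [inner_add_right, inner_smul_right, inner_smul_right]
  have h1 := mul_le_mul_of_nonneg_left (hx h hh) ha
  have h2 := mul_le_mul_of_nonneg_left (hy h hh) hb
  calc _ ≤ a * h.2 + b * h.2 := add_le_add h1 h2
    _ = h.2 := by rw [← add_mul, hab, one_mul]

theorem IsConvexPolyhedron.inter_hyperplane {P : Set E3} (hP : IsConvexPolyhedron P) {g : E3}
    (hg : g ≠ 0) (c : ℝ) : IsConvexPolyhedron {x ∈ P | inner ℝ g x = c} := by
  obtain ⟨hc, H, hf, h0, hPH⟩ := hP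
  refine ⟨?_, insert (g, c) (insert (-g, -c) H), (hf.insert _).insert _, ?_, ?_⟩
  · exact hc.inter_right (isClosed_eq (by fun_prop) continuous_const)
  · rintro h (rfl | rfl | hh)
    · exact hg
    · exact neg_ne_zero.2 hg
    · exact h0 h hh
  · subst hPH
    ext x
    simp only [Set.mem_ofPred_eq, Set.mem_insert_iff, forall_eq_or_imp, inner_neg_left,
      neg_le_neg_iff]
    constructor
    · rintro ⟨h1, rfl⟩
      exact ⟨le_rfl, le_rfl, h1⟩
    · rintro ⟨h1, h2, h3⟩
      exact ⟨h3, le_antisymm h1 h2⟩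

/-- The constraints of `H` that are tight at `x`. -/
def active (H : Set (E3 × ℝ)) (x : E3) : Set (E3 × ℝ) := {h ∈ H | inner ℝ h.1 x = h.2}

/-- From a point of a polyhedron one can move a little in every direction that does not
increase the tight constraints. -/
theorem exists_add_smul_mem {H : Set (E3 × ℝ)} (hH : H.Finite) {x y : E3}
    (hx : ∀ h ∈ H, inner ℝ h.1 x ≤ h.2) (hy : ∀ h ∈ active H x, inner ℝ h.1 y ≤ 0) :
    ∃ ε > (0 : ℝ), ∀ h ∈ H, inner ℝ h.1 (x + ε • y) ≤ h.2 := by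
  have key : ∀ h ∈ H, ∀ᶠ ε in nhdsWithin (0 : ℝ) (Set.Ioi 0), inner ℝ h.1 (x + ε • y) ≤ h.2 := by
    intro h hh
    by_cases ha : inner ℝ h.1 x = h.2
    · filter_upwards [self_mem_nhdsWithin] with ε hε
      rw [inner_add_right, inner_smul_right, ha]
      have := mul_nonpos_of_nonneg_of_nonpos (le_of_lt hε) (hy h ⟨hh, ha⟩)
      linarith
    · have hlt : inner ℝ h.1 x < h.2 := lt_of_le_of_ne (hx h hh) ha
      have hcont : Continuous fun ε : ℝ => inner ℝ h.1 (x + ε • y) := by fun_prop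
      have : ∀ᶠ ε in nhds (0 : ℝ), inner ℝ h.1 (x + ε • y) < h.2 :=
        hcont.continuousAt.eventually_lt continuousAt_const (by simpa using hlt)
      exact (this.filter_mono nhdsWithin_le_nhds).mono fun _ => le_of_lt
  obtain ⟨ε, h1, h2⟩ := (((Filter.eventually_all_finite hH).2 key).and
    (self_mem_nhdsWithin : Set.Ioi (0 : ℝ) ∈ nhdsWithin (0 : ℝ) (Set.Ioi 0))).exists
  exact ⟨ε, h2, h1⟩

theorem minFace_eq_active {H : Set (E3 × ℝ)} (hH : H.Finite) {x : E3}
    (hx : ∀ h ∈ H, inner ℝ h.1 x ≤ h.2) :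
    minFace {x | ∀ h ∈ H, inner ℝ h.1 x ≤ h.2} x =
      {y | (∀ h ∈ H, inner ℝ h.1 y ≤ h.2) ∧ ∀ h ∈ active H x, inner ℝ h.1 y = h.2} := by
  ext y
  constructor
  · rintro ⟨hy, ε, hε, hy'⟩
    refine ⟨hy, fun h hh => le_antisymm (hy h hh.1) ?_⟩
    have := hy' h hh.1
    rw [inner_add_right, inner_smul_right, inner_sub_right, hh.2] at this
    nlinarith
  · rintro ⟨hy, hy'⟩
    refine ⟨hy, ?_⟩
    obtain ⟨ε, hε, h⟩ := exists_add_smul_mem hH hx (y := x - y) fun h hh => by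
      rw [inner_sub_right, hh.2, hy' h hh, sub_self]
    exact ⟨ε, hε, h⟩

/-- The minimal face is cut out by the finitely many constraints tight at `x`; each cuts out an
exposed set, and exposed sets are closed under intersection. -/
theorem IsConvexPolyhedron.isExposed_minFace {P : Set E3} (hP : IsConvexPolyhedron P) {x : E3}
    (hx : x ∈ P) : IsExposed ℝ P (minFace P x) := by
  obtain ⟨-, H, hf, -, rfl⟩ := hP
  rw [minFace_eq_active hf hx]
  have hfa : (active H x).Finite := hf.subset fun h hh => hh.1
  have hsub : active H x ⊆ H := fun h hh => hh.1
  generalize active H x = A at hfa hsub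
  clear hx
  induction A, hfa using Set.Finite.induction_on with
  | empty => simpa using IsExposed.refl _
  | @insert a s _ _ ih =>
    have h1 := ih fun h hh => hsub (Set.mem_insert_of_mem _ hh)
    have h2 : IsExposed ℝ {x | ∀ h ∈ H, inner ℝ h.1 x ≤ h.2}
        {y ∈ {x | ∀ h ∈ H, inner ℝ h.1 x ≤ h.2} | inner ℝ a.1 y = a.2} :=
      isExposed_of_inner fun y hy => hy a (hsub (Set.mem_insert _ _))
    have e : {y | (∀ h ∈ H, inner ℝ h.1 y ≤ h.2) ∧ ∀ h ∈ insert a s, inner ℝ h.1 y = h.2} =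
        {y | (∀ h ∈ H, inner ℝ h.1 y ≤ h.2) ∧ ∀ h ∈ s, inner ℝ h.1 y = h.2} ∩
          {y ∈ {x | ∀ h ∈ H, inner ℝ h.1 x ≤ h.2} | inner ℝ a.1 y = a.2} := by
      ext y
      simp only [Set.mem_insert_iff, forall_eq_or_imp, Set.mem_ofPred_eq, Set.mem_inter_iff]
      tauto
    rw [e]
    exact h1.inter h2

/-- A point of `F` with the fewest tight constraints works. A constraint tight at the midpoint of
`x` and `y` is tight at both, so by minimality every constraint tight at `x` is tight at each `y` in
`F`. -/
theorem IsConvexPolyhedron.exists_eq_minFace {P F : Set E3} (hP : IsConvexPolyhedron P)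
    (hF : F.Nonempty) (h : IsExposed ℝ P F) : ∃ x ∈ F, F = minFace P x := by
  obtain ⟨hc, H, hf, h0, hPH⟩ := id hP
  have hfa : ∀ x, (active H x).Finite := fun x => hf.subset fun h hh => hh.1
  obtain ⟨x, hxF, hmin⟩ : ∃ x ∈ F, ∀ y ∈ F, (active H x).ncard ≤ (active H y).ncard := by
    obtain ⟨x, hx⟩ := hF
    have := WellFounded.has_min (measure fun x : F => (active H x).ncard).wf Set.univ
      ⟨⟨x, hx⟩, trivial⟩
    obtain ⟨⟨m, hm⟩, -, hm'⟩ := this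
    exact ⟨m, hm, fun y hy => not_lt.1 (hm' ⟨y, hy⟩ trivial)⟩
  refine ⟨x, hxF, Set.Subset.antisymm (fun y hy => ?_) (minFace_subset_of_isExposed h hxF)⟩
  have hxP := h.subset hxF
  have hyP := h.subset hy
  have hm := (h.convex hP.convex) hxF hy (a := 1 / 2) (b := 1 / 2) (by norm_num) (by norm_num)
    (by norm_num)
  rw [hPH] at hxP hyP ⊢
  rw [minFace_eq_active hf hxP]
  have key : ∀ h ∈ active H ((1 / 2 : ℝ) • x + (1 / 2 : ℝ) • y),
      inner ℝ h.1 x = h.2 ∧ inner ℝ h.1 y = h.2 := by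
    rintro h ⟨hh, hh'⟩
    rw [inner_add_right, inner_smul_right, inner_smul_right] at hh'
    have := hxP h hh
    have := hyP h hh
    constructor <;> linarith
  have hss : active H ((1 / 2 : ℝ) • x + (1 / 2 : ℝ) • y) ⊆ active H x :=
    fun h hh => ⟨hh.1, (key h hh).1⟩
  have := Set.eq_of_subset_of_ncard_le hss (hmin _ hm) (hfa x)
  refine ⟨hyP, fun h hh => ?_⟩
  rw [← this] at hh
  exact (key h hh).2

theorem IsConvexPolyhedron.mem_faces_iff {P F : Set E3} (hP : IsConvexPolyhedron P) {i : ℕ} :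
    F ∈ faces P i ↔ ∃ x ∈ P, F = minFace P x ∧ Module.finrank ℝ (vectorSpan ℝ F) = i := by
  constructor
  · rintro ⟨h1, h2, h3⟩
    obtain ⟨x, hx, rfl⟩ := hP.exists_eq_minFace h1 h2
    exact ⟨x, hx.1, rfl, h3⟩
  · rintro ⟨x, hx, rfl, h⟩
    exact ⟨⟨x, self_mem_minFace hx⟩, hP.isExposed_minFace hx, h⟩

theorem IsConvexPolyhedron.finite_faces {P : Set E3} (hP : IsConvexPolyhedron P) (i : ℕ) :
    (faces P i).Finite := by
  obtain ⟨hc, H, hf, h0, hPH⟩ := id hP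
  refine (hf.finite_subsets.image fun A => {y | y ∈ P ∧ ∀ h ∈ A, inner ℝ h.1 y = h.2}).subset ?_
  intro F hF
  obtain ⟨x, hx, rfl, -⟩ := hP.mem_faces_iff.1 hF
  refine ⟨active H x, fun h hh => hh.1, ?_⟩
  subst hPH
  rw [minFace_eq_active hf hx]
  rfl

theorem minFace_subset_of_mem_faces {P F : Set E3} {i : ℕ} {x : E3} (hF : F ∈ faces P i)
    (hx : x ∈ F) : minFace P x ⊆ F := minFace_subset_of_isExposed hF.2.1 hx

theorem subset_of_mem_faces {P F : Set E3} {i : ℕ} (hF : F ∈ faces P i) : F ⊆ P := hF.2.1.subset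

theorem IsConvexPolyhedron.minFace_subset_minFace {P : Set E3} (hP : IsConvexPolyhedron P)
    {x y : E3} (hx : x ∈ P) (hy : y ∈ minFace P x) : minFace P y ⊆ minFace P x :=
  minFace_subset_of_isExposed (hP.isExposed_minFace hx) hy

/-- Nested faces of the same dimension agree. -/
theorem IsConvexPolyhedron.face_eq_of_subset {P F G : Set E3} (hP : IsConvexPolyhedron P) {i : ℕ}
    (hF : F ∈ faces P i) (hG : G ∈ faces P i) (h : F ⊆ G) : F = G := by
  obtain ⟨x, hx, rfl, hi⟩ := hP.mem_faces_iff.1 hF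
  obtain ⟨z, hz, rfl, hi'⟩ := hP.mem_faces_iff.1 hG
  refine h.antisymm (hP.minFace_subset_minFace hx ?_)
  have hs : vectorSpan ℝ (minFace P x) = vectorSpan ℝ (minFace P z) :=
    Submodule.eq_of_le_of_finrank_eq (vectorSpan_mono ℝ h) (hi.trans hi'.symm)
  have hd : z - x ∈ vectorSpan ℝ (minFace P z) :=
    vsub_mem_vectorSpan ℝ (self_mem_minFace hz) (h (self_mem_minFace hx))
  rw [← hs, mem_vectorSpan_minFace hP.convex hx] at hd
  obtain ⟨ε, hε, -, h2⟩ := hd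
  refine ⟨hz, ε, hε, ?_⟩
  convert h2 using 1
  module

theorem IsConvexPolyhedron.of_isExposed {P F : Set E3} (hP : IsConvexPolyhedron P)
    (hF : F.Nonempty) (h : IsExposed ℝ P F) : IsConvexPolyhedron F := by
  obtain ⟨g, b, hb, rfl⟩ := exists_inner_of_isExposed hF h
  rcases eq_or_ne g 0 with rfl | hg
  · obtain ⟨w, hw, hw'⟩ := hF
    convert hP using 1
    rw [inner_zero_left] at hw'
    ext x
    simp [hw'.symm]
  · exact hP.inter_hyperplane hg b

theorem minFace_of_isExposed {P F : Set E3} {x : E3} (h : IsExposed ℝ P F) (hx : x ∈ F) :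
    minFace F x = minFace P x := by
  refine Set.Subset.antisymm ?_ ?_
  · rintro y ⟨hy, ε, hε, hy'⟩
    exact ⟨h.subset hy, ε, hε, h.subset hy'⟩
  · intro y hy
    have hyF := minFace_subset_of_isExposed h hx hy
    obtain ⟨hyP, ε, hε, hy'⟩ := hy
    -- The prolonged point is itself in `minFace P x`, with `y` as its own prolongation through `x`,
    -- so it lies in `F` as well.
    refine ⟨hyF, ε, hε, minFace_subset_of_isExposed h hx ⟨hy', ε⁻¹, by positivity, ?_⟩⟩
    convert hyP using 1
    rw [sub_add_cancel_left, smul_neg, smul_smul, inv_mul_cancel₀ hε.ne']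
    module

theorem IsConvexPolyhedron.faces_of_face {P F : Set E3} (hP : IsConvexPolyhedron P)
    {i j : ℕ} (hF : F ∈ faces P i) : faces F j = {G ∈ faces P j | G ⊆ F} := by
  have hFp := hP.of_isExposed hF.1 hF.2.1
  ext G
  rw [hFp.mem_faces_iff, Set.mem_ofPred_eq, hP.mem_faces_iff]
  constructor
  · rintro ⟨x, hx, rfl, h⟩
    exact ⟨⟨x, hF.2.1.subset hx, minFace_of_isExposed hF.2.1 hx, h⟩, minFace_subset⟩
  · rintro ⟨⟨x, hx, rfl, h⟩, hs⟩
    have hxF := hs (self_mem_minFace hx)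
    exact ⟨x, hxF, (minFace_of_isExposed hF.2.1 hxF).symm, h⟩

theorem left_mem_minFace_of_mem_openSegment {P : Set E3} {a b x : E3} (ha : a ∈ P) (hb : b ∈ P)
    (hx : x ∈ openSegment ℝ a b) : a ∈ minFace P x := by
  obtain ⟨α, β, hα, hβ, hαβ, rfl⟩ := hx
  refine ⟨ha, α / β, by positivity, ?_⟩
  convert hb using 1
  have h : α = 1 - β := by linarith
  subst h
  match_scalars <;> field_simp <;> ring

theorem right_mem_minFace_of_mem_openSegment {P : Set E3} {a b x : E3} (ha : a ∈ P) (hb : b ∈ P)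
    (hx : x ∈ openSegment ℝ a b) : b ∈ minFace P x :=
  left_mem_minFace_of_mem_openSegment hb ha (openSegment_symm ℝ a b ▸ hx)

/-! ### Vertices and edges. -/

theorem IsConvexPolyhedron.mem_vertices_iff {P : Set E3} (hP : IsConvexPolyhedron P) {v : E3} :
    v ∈ vertices P ↔ v ∈ P ∧ minFace P v = {v} := by
  constructor
  · intro h
    obtain ⟨x, hx, he, -⟩ := hP.mem_faces_iff.1 h
    have : x ∈ ({v} : Set E3) := he ▸ self_mem_minFace hx
    obtain rfl := Set.mem_singleton_iff.1 this
    exact ⟨hx, he.symm⟩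
  · rintro ⟨hv, h⟩
    exact hP.mem_faces_iff.2 ⟨v, hv, h.symm, by rw [vectorSpan_singleton, finrank_bot]⟩

theorem vertices_subset {P : Set E3} : vertices P ⊆ P := fun _ hv =>
  hv.2.1.subset (Set.mem_singleton _)

theorem mem_faces_zero_iff {P F : Set E3} :
    F ∈ faces P 0 ↔ ∃ v ∈ vertices P, F = {v} := by
  constructor
  · intro h
    obtain ⟨x, hx⟩ := h.1
    have hs : F.Subsingleton := by
      rw [← vectorSpan_eq_bot_iff_subsingleton (k := ℝ)]
      exact Submodule.finrank_eq_zero.1 h.2.2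
    obtain rfl := hs.eq_singleton_of_mem hx
    exact ⟨x, h, rfl⟩
  · rintro ⟨v, hv, rfl⟩
    exact hv

theorem faces_zero_eq {P : Set E3} : faces P 0 = (fun v => ({v} : Set E3)) '' vertices P := by
  ext F
  rw [mem_faces_zero_iff]
  simp only [Set.mem_image, eq_comm]

theorem fNumber_zero {P : Set E3} : fNumber P 0 = (vertices P).ncard := by
  rw [fNumber, faces_zero_eq]
  exact Set.ncard_image_of_injective _ Set.singleton_injective

theorem IsConvexPolyhedron.finite_vertices {P : Set E3} (hP : IsConvexPolyhedron P) :
    (vertices P).Finite := by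
  have := hP.finite_faces 0
  rw [faces_zero_eq] at this
  exact this.of_finite_image Set.singleton_injective.injOn

theorem IsConvexPolyhedron.vertices_of_face {P F : Set E3} (hP : IsConvexPolyhedron P)
    {i : ℕ} (hF : F ∈ faces P i) : vertices F = {v ∈ vertices P | v ∈ F} := by
  ext v
  simp only [vertices, hP.faces_of_face hF, Set.mem_ofPred_eq, Set.singleton_subset_iff]

theorem IsConvexPolyhedron.convexHull_vertices {P : Set E3} (hP : IsConvexPolyhedron P) :
    convexHull ℝ (vertices P) = P := by
  refine Set.Subset.antisymm (convexHull_min vertices_subset hP.convex) ?_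
  have h := closure_convexHull_extremePoints hP.1 hP.convex
  rw [← hP.finite_vertices.isClosed_convexHull ℝ |>.closure_eq]
  conv_lhs => rw [← h]
  refine closure_mono (convexHull_mono fun x hx => ?_)
  rw [mem_extremePoints] at hx
  refine hP.mem_vertices_iff.2 ⟨hx.1, Set.Subset.antisymm ?_ ?_⟩
  · rintro y ⟨hy, ε, hε, hy'⟩
    -- These weights write `x` as a convex combination of `y` and `x + ε • (x - y)`.
    refine (hx.2 y hy _ hy' ⟨ε / (1 + ε), 1 / (1 + ε), by positivity, by positivity, ?_, ?_⟩).1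
    · field_simp
      ring
    · match_scalars <;> field_simp
      ring
  · exact Set.singleton_subset_iff.2 (self_mem_minFace hx.1)

theorem IsConvexPolyhedron.nonempty_vertices {P : Set E3} (hP : IsConvexPolyhedron P)
    (h : P.Nonempty) : (vertices P).Nonempty := by
  rwa [← convexHull_nonempty_iff (𝕜 := ℝ), hP.convexHull_vertices]

theorem convex_inner_le (g : E3) (c : ℝ) : Convex ℝ {x : E3 | inner ℝ g x ≤ c} :=
  convex_halfSpace_le (f := fun x => inner ℝ g x)
    (IsLinearMap.mk (fun _ _ => inner_add_right _ _ _) fun _ _ => inner_smul_right _ _ _) c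

theorem IsConvexPolyhedron.inner_le_of_vertices {P : Set E3} (hP : IsConvexPolyhedron P) {g : E3}
    {c : ℝ} (h : ∀ u ∈ vertices P, inner ℝ g u ≤ c) : ∀ y ∈ P, inner ℝ g y ≤ c := by
  intro y hy
  rw [← hP.convexHull_vertices] at hy
  exact convexHull_min (fun u hu => h u hu) (convex_inner_le g c) hy

theorem IsConvexPolyhedron.exists_vertex_max {P : Set E3} (hP : IsConvexPolyhedron P)
    (hne : P.Nonempty) (g : E3) :
    ∃ u ∈ vertices P, ∀ y ∈ P, inner ℝ g y ≤ inner ℝ g u := by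
  obtain ⟨u, hu, h⟩ := hP.finite_vertices.exists_maximalFor (fun u => inner ℝ g u) _
    (hP.nonempty_vertices hne)
  refine ⟨u, hu, hP.inner_le_of_vertices fun w hw => ?_⟩
  by_contra hlt
  exact hlt (h hw (not_le.1 hlt).le)

theorem IsConvexPolyhedron.exists_vertex_min {P : Set E3} (hP : IsConvexPolyhedron P)
    (hne : P.Nonempty) (g : E3) :
    ∃ u ∈ vertices P, ∀ y ∈ P, inner ℝ g u ≤ inner ℝ g y := by
  obtain ⟨u, hu, h⟩ := hP.exists_vertex_max hne (-g)
  exact ⟨u, hu, fun y hy => by simpa using h y hy⟩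

/-- A one-dimensional polyhedron is a segment between its two vertices. -/
theorem IsConvexPolyhedron.eq_segment {F : Set E3} (hF : IsConvexPolyhedron F)
    (hd : Module.finrank ℝ (vectorSpan ℝ F) = 1) :
    ∃ a b, a ≠ b ∧ F = segment ℝ a b ∧ vertices F = {a, b} := by
  obtain ⟨⟨d, hdF⟩, hd0, hspan⟩ := finrank_eq_one_iff'.1 hd
  have hd0' : d ≠ 0 := fun h => hd0 (Subtype.ext h)
  have hne : F.Nonempty := by
    by_contra h
    rw [Set.not_nonempty_iff_eq_empty] at h
    rw [h, vectorSpan_empty, finrank_bot] at hd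
    exact zero_ne_one hd
  obtain ⟨a, ha, hamin⟩ := hF.exists_vertex_min hne d
  obtain ⟨b, hb, hbmax⟩ := hF.exists_vertex_max hne d
  have haF := vertices_subset ha
  have hbF := vertices_subset hb
  have hpar : ∀ y ∈ F, ∃ s : ℝ, y = a + s • d := by
    intro y hy
    obtain ⟨s, hs⟩ := hspan ⟨y - a, vsub_mem_vectorSpan ℝ hy haF⟩
    refine ⟨s, ?_⟩
    have := congrArg Subtype.val hs
    simp only [Submodule.coe_smul] at this
    rw [this]
    abel
  have hdd : 0 < inner ℝ d d := by
    rw [real_inner_self_eq_norm_sq]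
    have := norm_pos_iff.2 hd0'
    positivity
  obtain ⟨S, hS⟩ := hpar b hbF
  have hseg : F = segment ℝ a b := by
    refine Set.Subset.antisymm (fun y hy => ?_) (hF.convex.segment_subset haF hbF)
    obtain ⟨s, rfl⟩ := hpar y hy
    have h1 := hamin _ hy
    have h2 := hbmax _ hy
    rw [hS] at h2
    simp only [inner_add_right, inner_smul_right] at h1 h2
    have hs0 : 0 ≤ s := by
      by_contra h
      nlinarith [not_le.1 h]
    have hsS : s ≤ S := by
      by_contra h
      nlinarith [not_le.1 h]
    rw [segment_eq_image']
    rcases hs0.eq_or_lt with rfl | hpos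
    · exact ⟨0, by simp, by simp⟩
    · have hSpos := hpos.trans_le hsS
      refine ⟨s / S, ⟨by positivity, (div_le_one hSpos).2 hsS⟩, ?_⟩
      simp only [hS, add_sub_cancel_left, smul_smul, div_mul_cancel₀ _ hSpos.ne']
  have hab : a ≠ b := by
    rintro rfl
    rw [hseg, segment_same, vectorSpan_singleton, finrank_bot] at hd
    exact zero_ne_one hd
  refine ⟨a, b, hab, hseg, Set.Subset.antisymm (fun u hu => ?_) ?_⟩
  · have hu' : u ∈ segment ℝ a b := hseg ▸ vertices_subset hu
    rw [← insert_endpoints_openSegment] at hu'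
    rcases hu' with rfl | rfl | h
    · simp
    · simp
    · have := left_mem_minFace_of_mem_openSegment haF hbF h
      rw [(hF.mem_vertices_iff.1 hu).2] at this
      exact Or.inl this.symm
  · rintro u (rfl | rfl)
    · exact ha
    · exact hb

/-- An edge is a segment between two vertices, and contains no other vertices. -/
theorem IsConvexPolyhedron.exists_edge_ends {P F : Set E3} (hP : IsConvexPolyhedron P)
    (hF : F ∈ faces P 1) : ∃ a b, a ≠ b ∧ F = segment ℝ a b ∧ a ∈ vertices P ∧ b ∈ vertices P ∧
      ∀ u ∈ vertices P, u ∈ F → u = a ∨ u = b := by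
  obtain ⟨a, b, hab, h1, h2⟩ := (hP.of_isExposed hF.1 hF.2.1).eq_segment hF.2.2
  rw [hP.vertices_of_face hF] at h2
  have ha : a ∈ ({a, b} : Set E3) := by simp
  have hb : b ∈ ({a, b} : Set E3) := by simp
  rw [← h2] at ha hb
  refine ⟨a, b, hab, h1, ha.1, hb.1, fun u hu huF => ?_⟩
  have : u ∈ ({a, b} : Set E3) := h2 ▸ ⟨hu, huF⟩
  simpa using this

/-! ### Hyperplane sections. -/

/-- The section of `P` by the hyperplane `⟪g, x⟫ = c`. -/
def slice (P : Set E3) (g : E3) (c : ℝ) : Set E3 := {x ∈ P | inner ℝ g x = c}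

/-- `F` has points strictly on both sides of the hyperplane `⟪g, x⟫ = c`. -/
def Crosses (g : E3) (c : ℝ) (F : Set E3) : Prop :=
  (∃ y ∈ F, inner ℝ g y < c) ∧ ∃ z ∈ F, c < inner ℝ g z

theorem minFace_slice {P : Set E3} {g x : E3} {c : ℝ} (hx : inner ℝ g x = c) :
    minFace (slice P g c) x = slice (minFace P x) g c := by
  ext y
  constructor
  · rintro ⟨⟨hy, hc⟩, ε, hε, h⟩
    exact ⟨⟨hy, ε, hε, h.1⟩, hc⟩
  · rintro ⟨⟨hy, ε, hε, h⟩, hc⟩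
    refine ⟨⟨hy, hc⟩, ε, hε, h, ?_⟩
    rw [inner_add_right, inner_smul_right, inner_sub_right, hx, hc]
    ring

theorem convex_slice {P : Set E3} (hP : Convex ℝ P) (g : E3) (c : ℝ) : Convex ℝ (slice P g c) := by
  rintro x ⟨hx, hx'⟩ y ⟨hy, hy'⟩ a b ha hb hab
  refine ⟨hP hx hy ha hb hab, ?_⟩
  rw [inner_add_right, inner_smul_right, inner_smul_right, hx', hy', ← add_mul, hab, one_mul]

theorem vectorSpan_slice_minFace {P : Set E3} (hP : Convex ℝ P) {g x : E3} {c : ℝ} (hxP : x ∈ P)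
    (hx : inner ℝ g x = c) :
    vectorSpan ℝ (slice (minFace P x) g c) =
      vectorSpan ℝ (minFace P x) ⊓ LinearMap.ker (innerₛₗ ℝ g) := by
  rw [← minFace_slice hx]
  ext y
  rw [mem_vectorSpan_minFace (convex_slice hP g c) ⟨hxP, hx⟩, Submodule.mem_inf,
    mem_vectorSpan_minFace hP hxP, LinearMap.mem_ker, innerₛₗ_apply_apply]
  constructor
  · rintro ⟨ε, hε, ⟨h1, h2⟩, ⟨h3, h4⟩⟩
    refine ⟨⟨ε, hε, h1, h3⟩, ?_⟩
    rw [inner_add_right, inner_smul_right, hx, add_eq_left] at h2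
    exact (mul_eq_zero.1 h2).resolve_left hε.ne'
  · rintro ⟨⟨ε, hε, h1, h3⟩, h0⟩
    refine ⟨ε, hε, ⟨h1, ?_⟩, ⟨h3, ?_⟩⟩
    · rw [inner_add_right, inner_smul_right, hx, h0, mul_zero, add_zero]
    · rw [inner_sub_right, inner_smul_right, hx, h0, mul_zero, sub_zero]

theorem finrank_inf_ker_add_one {V : Submodule ℝ E3} {g d : E3} (hd : d ∈ V)
    (hgd : inner ℝ g d ≠ 0) :
    Module.finrank ℝ ↥(V ⊓ LinearMap.ker (innerₛₗ ℝ g)) + 1 = Module.finrank ℝ V := by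
  have hne : (innerₛₗ ℝ g).domRestrict V ≠ 0 := fun h => hgd (by
    simpa using LinearMap.congr_fun h ⟨d, hd⟩)
  have h1 := Module.Dual.finrank_ker_add_one_of_ne_zero (f := (innerₛₗ ℝ g).domRestrict V) hne
  rw [← h1, LinearMap.ker_domRestrict, ← Submodule.map_comap_subtype,
    Submodule.finrank_map_subtype_eq]

/-- A relatively interior point of `F` can be slid towards a point of `F` on the other side until it
meets the hyperplane. It stays relatively interior along the open segment, so its minimal face is
still `F`. -/
theorem IsConvexPolyhedron.exists_minFace_eq_of_crosses {P F : Set E3} (hP : IsConvexPolyhedron P)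
    {i : ℕ} (hF : F ∈ faces P i) {g : E3} {c : ℝ} (h : Crosses g c F) :
    ∃ x ∈ P, F = minFace P x ∧ inner ℝ g x = c := by
  obtain ⟨x, hx, rfl, -⟩ := hP.mem_faces_iff.1 hF
  have key : ∀ (z : E3) (θ : ℝ), z ∈ minFace P x → 0 < θ → θ < 1 →
      inner ℝ g (x + θ • (z - x)) = c → ∃ x' ∈ P, minFace P x = minFace P x' ∧ inner ℝ g x' = c := by
    intro z θ hz h0 h1 hc
    have hmem : x + θ • (z - x) ∈ openSegment ℝ x z :=
      ⟨1 - θ, θ, by linarith, h0, by ring, by module⟩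
    have hx' : x + θ • (z - x) ∈ minFace P x :=
      (hF.2.1.convex hP.convex).openSegment_subset (self_mem_minFace hx) hz hmem
    exact ⟨_, hx'.1, Set.Subset.antisymm
      (hP.minFace_subset_minFace hx'.1 (left_mem_minFace_of_mem_openSegment hx hz.1 hmem))
      (hP.minFace_subset_minFace hx hx'), hc⟩
  obtain ⟨⟨y, hy, hyc⟩, z, hz, hzc⟩ := h
  rcases lt_trichotomy (inner ℝ g x) c with hlt | heq | hgt
  · refine key z ((c - inner ℝ g x) / (inner ℝ g z - inner ℝ g x)) hz
      (div_pos (by linarith) (by linarith)) ((div_lt_one (by linarith)).2 (by linarith)) ?_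
    rw [inner_add_right, inner_smul_right, inner_sub_right, div_mul_cancel₀ _ (by linarith)]
    ring
  · exact ⟨x, hx, rfl, heq⟩
  · refine key y ((inner ℝ g x - c) / (inner ℝ g x - inner ℝ g y)) hy
      (div_pos (by linarith) (by linarith)) ((div_lt_one (by linarith)).2 (by linarith)) ?_
    rw [inner_add_right, inner_smul_right, inner_sub_right,
      show inner ℝ g y - inner ℝ g x = -(inner ℝ g x - inner ℝ g y) by ring, mul_neg,
      div_mul_cancel₀ _ (by linarith)]
    ring

/-- The faces of a hyperplane section are the sections of the faces that cross the hyperplane,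
of one dimension more, and the faces that lie in the hyperplane. -/
theorem IsConvexPolyhedron.bijOn_slice {P : Set E3} (hP : IsConvexPolyhedron P) {g : E3}
    (hg : g ≠ 0) (c : ℝ) (j : ℕ) :
    Set.BijOn (fun F => slice F g c)
      ({F ∈ faces P (j + 1) | Crosses g c F} ∪ {F ∈ faces P j | ∀ y ∈ F, inner ℝ g y = c})
      (faces (slice P g c) j) := by
  have hS : IsConvexPolyhedron (slice P g c) := hP.inter_hyperplane hg c
  have hrep : ∀ F ∈ ({F ∈ faces P (j + 1) | Crosses g c F} ∪
      {F ∈ faces P j | ∀ y ∈ F, inner ℝ g y = c}),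
      ∃ x ∈ P, F = minFace P x ∧ inner ℝ g x = c := by
    rintro F (⟨hF, hc⟩ | ⟨hF, hc⟩)
    · exact hP.exists_minFace_eq_of_crosses hF hc
    · obtain ⟨x, hx, rfl, -⟩ := hP.mem_faces_iff.1 hF
      exact ⟨x, hx, rfl, hc x (self_mem_minFace hx)⟩
  refine ⟨?_, ?_, ?_⟩
  · intro F hF
    obtain ⟨x, hx, rfl, hxc⟩ := hrep F hF
    refine hS.mem_faces_iff.2 ⟨x, ⟨hx, hxc⟩, (minFace_slice hxc).symm, ?_⟩
    rcases hF with ⟨hF, ⟨y, hy, hyc⟩, -⟩ | ⟨hF, hc⟩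
    · have := finrank_inf_ker_add_one (g := g)
        (vsub_mem_vectorSpan ℝ hy (self_mem_minFace hx)) (by
          rw [vsub_eq_sub, inner_sub_right]
          linarith)
      rw [vectorSpan_slice_minFace hP.convex hx hxc]
      have h2 := hF.2.2
      omega
    · have : slice (minFace P x) g c = minFace P x := Set.sep_eq_self_iff_mem_true.2 hc
      exact (congrArg (fun A => Module.finrank ℝ (vectorSpan ℝ A)) this).trans hF.2.2
  · intro F hF G hG h
    obtain ⟨x, hx, rfl, hxc⟩ := hrep F hF
    obtain ⟨z, hz, rfl, hzc⟩ := hrep G hG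
    simp only at h
    have h1 : x ∈ slice (minFace P z) g c := h ▸ ⟨self_mem_minFace hx, hxc⟩
    have h2 : z ∈ slice (minFace P x) g c := h ▸ ⟨self_mem_minFace hz, hzc⟩
    exact Set.Subset.antisymm (hP.minFace_subset_minFace hz h1.1) (hP.minFace_subset_minFace hx h2.1)
  · intro G hG
    obtain ⟨x, ⟨hx, hxc⟩, rfl, hd⟩ := hS.mem_faces_iff.1 hG
    refine ⟨minFace P x, ?_, (minFace_slice hxc).symm⟩
    rw [minFace_slice hxc, vectorSpan_slice_minFace hP.convex hx hxc] at hd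
    by_cases h : ∃ d ∈ vectorSpan ℝ (minFace P x), inner ℝ g d ≠ 0
    · obtain ⟨d, hd', hgd⟩ := h
      have h1 := finrank_inf_ker_add_one hd' hgd
      rw [hd] at h1
      refine Or.inl ⟨hP.mem_faces_iff.2 ⟨x, hx, rfl, h1.symm⟩, ?_⟩
      obtain ⟨ε, hε, h1, h2⟩ := (mem_vectorSpan_minFace hP.convex hx).1 hd'
      have m1 : x + ε • d ∈ minFace P x := ⟨h1, 1, one_pos, by convert h2 using 1; module⟩
      have m2 : x - ε • d ∈ minFace P x := ⟨h2, 1, one_pos, by convert h1 using 1; module⟩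
      have e1 : inner ℝ g (x + ε • d) = c + ε * inner ℝ g d := by
        rw [inner_add_right, inner_smul_right, hxc]
      have e2 : inner ℝ g (x - ε • d) = c - ε * inner ℝ g d := by
        rw [inner_sub_right, inner_smul_right, hxc]
      rcases lt_or_gt_of_ne hgd with hlt | hgt
      · have := mul_neg_of_pos_of_neg hε hlt
        exact ⟨⟨_, m1, by linarith⟩, _, m2, by linarith⟩
      · have := mul_pos hε hgt
        exact ⟨⟨_, m2, by linarith⟩, _, m1, by linarith⟩
    · push Not at h
      have hin : vectorSpan ℝ (minFace P x) ⊓ LinearMap.ker (innerₛₗ ℝ g) =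
          vectorSpan ℝ (minFace P x) :=
        inf_eq_left.2 fun d hd => by simpa using h d hd
      rw [hin] at hd
      refine Or.inr ⟨hP.mem_faces_iff.2 ⟨x, hx, rfl, hd⟩, fun y hy => ?_⟩
      have := h (y - x) (vsub_mem_vectorSpan ℝ hy (self_mem_minFace hx))
      rw [inner_sub_right, hxc] at this
      linarith

/-! ### Double counting, cutting off a vertex, and local incidences. -/

theorem ncard_mul_eq_ncard_mul {α β : Type*} {s : Set α} {t : Set β} (hs : s.Finite)
    (ht : t.Finite) (r : α → β → Prop) {m n : ℕ} (hm : ∀ a ∈ s, {b ∈ t | r a b}.ncard = m)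
    (hn : ∀ b ∈ t, {a ∈ s | r a b}.ncard = n) : s.ncard * m = t.ncard * n := by
  classical
  lift s to Finset α using hs
  lift t to Finset β using ht
  rw [Set.ncard_coe_finset, Set.ncard_coe_finset]
  refine Finset.card_mul_eq_card_mul r (fun a ha => ?_) fun b hb => ?_
  · rw [← hm a ha, ← Set.ncard_coe_finset, Finset.coe_bipartiteAbove]
    rfl
  · rw [← hn b hb, ← Set.ncard_coe_finset, Finset.coe_bipartiteBelow]
    rfl

theorem exists_between_of_finite {α : Type*} {s : Set α} (hs : s.Finite) {f : α → ℝ} {b : ℝ}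
    (h : ∀ a ∈ s, f a < b) : ∃ c < b, ∀ a ∈ s, f a < c := by
  have key : ∀ a ∈ s, ∀ᶠ c in nhdsWithin b (Set.Iio b), f a < c := fun a ha =>
    (eventually_gt_nhds (h a ha)).filter_mono nhdsWithin_le_nhds
  obtain ⟨c, h1, h2⟩ := (((Filter.eventually_all_finite hs).2 key).and
    (self_mem_nhdsWithin : Set.Iio b ∈ nhdsWithin b (Set.Iio b))).exists
  exact ⟨c, h2, h1⟩

theorem IsConvexPolyhedron.subset_singleton_of_vertices {F : Set E3} (hF : IsConvexPolyhedron F)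
    {v : E3} (h : vertices F ⊆ {v}) : F ⊆ {v} := by
  have := convexHull_mono (𝕜 := ℝ) h
  rwa [hF.convexHull_vertices, convexHull_singleton] at this

theorem IsConvexPolyhedron.exists_vertex_ne {P F : Set E3} (hP : IsConvexPolyhedron P) {i : ℕ}
    (hF : F ∈ faces P (i + 1)) (v : E3) : ∃ u ∈ vertices P, u ∈ F ∧ u ≠ v := by
  by_contra! h
  have hs : F ⊆ {v} := (hP.of_isExposed hF.1 hF.2.1).subset_singleton_of_vertices fun u hu => by
    rw [hP.vertices_of_face hF] at hu
    exact h u hu.1 hu.2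
  have h1 := hF.2.2
  rw [(vectorSpan_eq_bot_iff_subsingleton (k := ℝ)).2 (Set.subsingleton_singleton.anti hs),
    finrank_bot] at h1
  omega

theorem IsConvexPolyhedron.exists_vertex_mem {P F : Set E3} (hP : IsConvexPolyhedron P) {i : ℕ}
    (hF : F ∈ faces P i) : ∃ u ∈ vertices P, u ∈ F := by
  obtain ⟨u, hu⟩ := (hP.of_isExposed hF.1 hF.2.1).nonempty_vertices hF.1
  rw [hP.vertices_of_face hF] at hu
  exact ⟨u, hu.1, hu.2⟩

/-- The hyperplane `⟪g, x⟫ = c` separates the vertex `v` of `P` from the other vertices. -/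
structure CutsOff (P : Set E3) (v g : E3) (c : ℝ) : Prop where
  mem : v ∈ vertices P
  ne_zero : g ≠ 0
  lt : c < inner ℝ g v
  gt : ∀ u ∈ vertices P, u ≠ v → inner ℝ g u < c

/-- A functional exposing `v` takes smaller values at `x` and at the other vertices; these are
finitely many values, so a level fits between them and the maximum. -/
theorem IsConvexPolyhedron.exists_cutsOff {P : Set E3} (hP : IsConvexPolyhedron P) {v x : E3}
    (hv : v ∈ vertices P) (hx : x ∈ P) (hxv : x ≠ v) :
    ∃ g c, CutsOff P v g c ∧ inner ℝ g x < c := by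
  obtain ⟨g, b, hb, he⟩ := exists_inner_of_isExposed (Set.singleton_nonempty v) hv.2.1
  have hlt : ∀ y ∈ P, y ≠ v → inner ℝ g y < b := fun y hy hyv =>
    lt_of_le_of_ne (hb y hy) fun h => hyv (by
      have : y ∈ ({v} : Set E3) := he ▸ ⟨hy, h⟩
      simpa using this)
  have hvb : inner ℝ g v = b := by
    have : v ∈ {x ∈ P | inner ℝ g x = b} := he ▸ Set.mem_singleton v
    exact this.2
  obtain ⟨c, hc, h⟩ := exists_between_of_finite (f := fun y => inner ℝ g y) (b := b)
    (s := insert x (vertices P \ {v})) ((hP.finite_vertices.sdiff).insert x) (by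
      rintro y (rfl | ⟨hy, hyv⟩)
      · exact hlt y hx hxv
      · exact hlt y (vertices_subset hy) hyv)
  refine ⟨g, c, ⟨hv, ?_, hvb ▸ hc, fun u hu huv => h u (Or.inr ⟨hu, huv⟩)⟩, h x (Or.inl rfl)⟩
  rintro rfl
  have := hlt x hx hxv
  rw [inner_zero_left] at this hvb
  exact this.ne hvb

namespace CutsOff

variable {P : Set E3} {v g : E3} {c : ℝ}

theorem crosses_iff (h : CutsOff P v g c) (hP : IsConvexPolyhedron P) {F : Set E3} {j : ℕ}
    (hF : F ∈ faces P (j + 1)) : Crosses g c F ↔ v ∈ F := by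
  constructor
  · rintro ⟨-, z, hz, hzc⟩
    by_contra hv
    refine hzc.not_ge ((hP.of_isExposed hF.1 hF.2.1).inner_le_of_vertices (fun u hu => ?_) z hz)
    rw [hP.vertices_of_face hF] at hu
    exact (h.gt u hu.1 fun e => hv (e ▸ hu.2)).le
  · intro hv
    obtain ⟨u, hu, huF, huv⟩ := hP.exists_vertex_ne hF v
    exact ⟨⟨u, huF, h.gt u hu huv⟩, v, hv, h.lt⟩

/-- The section that cuts off a vertex `v` has as its faces the sections of the faces at `v`. -/
theorem bijOn (h : CutsOff P v g c) (hP : IsConvexPolyhedron P) (j : ℕ) :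
    Set.BijOn (fun F => slice F g c) {F ∈ faces P (j + 1) | v ∈ F} (faces (slice P g c) j) := by
  convert hP.bijOn_slice h.ne_zero c j using 1
  have h0 : {F ∈ faces P j | ∀ y ∈ F, inner ℝ g y = c} = ∅ := by
    refine Set.eq_empty_of_forall_notMem fun F hF => ?_
    obtain ⟨u, hu, huF⟩ := hP.exists_vertex_mem hF.1
    have := hF.2 u huF
    by_cases huv : u = v
    · have := h.lt
      subst huv
      linarith
    · have := h.gt u hu huv
      linarith
  rw [h0, Set.union_empty]
  ext F
  exact and_congr_right fun hF => (h.crosses_iff hP hF).symm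

theorem isConvexPolyhedron (h : CutsOff P v g c) (hP : IsConvexPolyhedron P) :
    IsConvexPolyhedron (slice P g c) := hP.inter_hyperplane h.ne_zero c

theorem finrank_slice (h : CutsOff P v g c) (hP : IsConvexPolyhedron P) {d : ℕ}
    (hd : Module.finrank ℝ (vectorSpan ℝ P) = d + 1) :
    Module.finrank ℝ (vectorSpan ℝ (slice P g c)) = d :=
  ((h.bijOn hP d).mapsTo
    ⟨⟨⟨v, vertices_subset h.mem⟩, IsExposed.refl P, hd⟩, vertices_subset h.mem⟩).2.2

theorem exists_mem_vertices (h : CutsOff P v g c) (hP : IsConvexPolyhedron P) {e : Set E3}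
    (he : e ∈ faces P 1) (hv : v ∈ e) :
    ∃ u ∈ vertices (slice P g c), slice e g c = {u} ∧ e = minFace P u := by
  obtain ⟨u, hu, heu⟩ := mem_faces_zero_iff.1 ((h.bijOn hP 0).mapsTo ⟨he, hv⟩)
  obtain ⟨x, hx, hex, hxc⟩ := hP.exists_minFace_eq_of_crosses he ((h.crosses_iff hP he).2 hv)
  have : x ∈ slice e g c := ⟨hex ▸ self_mem_minFace hx, hxc⟩
  rw [heu] at this
  obtain rfl := Set.mem_singleton_iff.1 this
  exact ⟨x, hu, heu, hex⟩

theorem minFace_mem_faces (h : CutsOff P v g c) (hP : IsConvexPolyhedron P) {u : E3}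
    (hu : u ∈ vertices (slice P g c)) : minFace P u ∈ faces P 1 ∧ v ∈ minFace P u := by
  obtain ⟨e, ⟨he, hv⟩, heu⟩ := (h.bijOn hP 0).surjOn hu
  obtain ⟨u', -, hu'', rfl⟩ := h.exists_mem_vertices hP he hv
  simp only at heu
  rw [hu''] at heu
  obtain rfl := Set.singleton_injective heu
  exact ⟨he, hv⟩

end CutsOff

/-- Cutting `v` off a polygon leaves a segment as section, whose two ends are the sections of the
edges at `v`. -/
theorem IsConvexPolyhedron.ncard_edges_at_vertex {P : Set E3} (hP : IsConvexPolyhedron P)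
    (hd : Module.finrank ℝ (vectorSpan ℝ P) = 2) {v : E3} (hv : v ∈ vertices P) :
    {e ∈ faces P 1 | v ∈ e}.ncard = 2 := by
  have hPP : P ∈ faces P (1 + 1) := ⟨⟨v, vertices_subset hv⟩, IsExposed.refl P, hd⟩
  obtain ⟨u, hu, huP, huv⟩ := hP.exists_vertex_ne hPP v
  obtain ⟨g, c, h, -⟩ := hP.exists_cutsOff hv huP huv
  obtain ⟨a, b, hab, -, hV⟩ := (h.isConvexPolyhedron hP).eq_segment (h.finrank_slice hP hd)
  rw [Set.BijOn.ncard_eq (h.bijOn hP 0), faces_zero_eq,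
    Set.ncard_image_of_injective _ Set.singleton_injective, hV, Set.ncard_pair hab]

/-- Every vertex of a facet lies on exactly two edges of the facet. -/
theorem IsConvexPolyhedron.ncard_edges_of_flag {P F : Set E3} (hP : IsConvexPolyhedron P)
    (hF : F ∈ faces P 2) {v : E3} (hv : v ∈ vertices P) (hvF : v ∈ F) :
    {e ∈ faces P 1 | v ∈ e ∧ e ⊆ F}.ncard = 2 := by
  rw [← (hP.of_isExposed hF.1 hF.2.1).ncard_edges_at_vertex hF.2.2
    (by rw [hP.vertices_of_face hF]; exact ⟨hv, hvF⟩ : v ∈ vertices F), hP.faces_of_face hF]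
  congr 1
  ext e
  simp only [Set.mem_ofPred_eq]
  tauto

/-- Every edge of a three-dimensional polyhedron lies in exactly two facets. -/
theorem IsConvexPolyhedron.ncard_facets_of_edge {P e : Set E3} (hP : IsConvexPolyhedron P)
    (hd : Module.finrank ℝ (vectorSpan ℝ P) = 3) (he : e ∈ faces P 1) :
    {F ∈ faces P 2 | e ⊆ F}.ncard = 2 := by
  obtain ⟨v, hv, hve⟩ := hP.exists_vertex_mem he
  obtain ⟨w, hw, hwe, hwv⟩ := hP.exists_vertex_ne he v
  obtain ⟨g, c, h, -⟩ := hP.exists_cutsOff hv (vertices_subset hw) hwv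
  obtain ⟨u, hu, hue, heu⟩ := h.exists_mem_vertices hP he hve
  have hT := h.isConvexPolyhedron hP
  -- In the polygon that cuts off `v`, the edge `e` becomes the vertex `u` and the facets through
  -- `e` become the edges at `u`.
  refine Eq.trans ?_ (hT.ncard_edges_at_vertex (h.finrank_slice hP hd) hu)
  refine Set.BijOn.ncard_eq (f := fun F => slice F g c) ⟨?_, ?_, ?_⟩
  · rintro F ⟨hF, heF⟩
    refine ⟨(h.bijOn hP 1).mapsTo ⟨hF, heF hve⟩, ?_⟩
    have : u ∈ slice e g c := hue ▸ Set.mem_singleton u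
    exact ⟨heF this.1, this.2⟩
  · exact fun F hF G hG h' => (h.bijOn hP 1).injOn ⟨hF.1, hF.2 hve⟩ ⟨hG.1, hG.2 hve⟩ h'
  · rintro G ⟨hG, huG⟩
    obtain ⟨F, ⟨hF, hvF⟩, rfl⟩ := (h.bijOn hP 1).surjOn hG
    exact ⟨F, ⟨hF, heu ▸ minFace_subset_of_mem_faces hF huG.1⟩, rfl⟩

theorem IsConvexPolyhedron.ncard_vertices_of_edge {P e : Set E3} (hP : IsConvexPolyhedron P)
    (he : e ∈ faces P 1) : {v ∈ vertices P | v ∈ e}.ncard = 2 := by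
  obtain ⟨a, b, hab, -, h⟩ := (hP.of_isExposed he.1 he.2.1).eq_segment he.2.2
  rw [← hP.vertices_of_face he, h, Set.ncard_pair hab]

/-- A polygon has as many edges as vertices. -/
theorem IsConvexPolyhedron.ncard_edges_eq {P : Set E3} (hP : IsConvexPolyhedron P)
    (hd : Module.finrank ℝ (vectorSpan ℝ P) = 2) : (faces P 1).ncard = (faces P 0).ncard := by
  have h := ncard_mul_eq_ncard_mul hP.finite_vertices (hP.finite_faces 1) (fun v e => v ∈ e)
    (fun v hv => hP.ncard_edges_at_vertex hd hv) fun e he => hP.ncard_vertices_of_edge he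
  have h0 : (faces P 0).ncard = (vertices P).ncard := fNumber_zero
  omega

/-! ### The graph: ends of edges, cones at vertices, connectedness. -/

/-- Adjacency only says that the segment is an edge. Some vertex of that edge minimizes the
functional `w - v` on it, and the only minimizer is `v`. -/
theorem IsConvexPolyhedron.left_mem_vertices_of_adj {P : Set E3} (hP : IsConvexPolyhedron P)
    {v w : E3} (h : (graph P).Adj v w) : v ∈ vertices P := by
  have hF : segment ℝ v w ∈ faces P 1 := h
  have hvw : v ≠ w := h.ne
  obtain ⟨u, hu, hmin⟩ := (hP.of_isExposed hF.1 hF.2.1).exists_vertex_min hF.1 (w - v)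
  have huv := hmin v (left_mem_segment ℝ v w)
  have hus := vertices_subset hu
  rw [hP.vertices_of_face hF] at hu
  rw [segment_eq_image'] at hus
  obtain ⟨θ, ⟨h0, h1⟩, rfl⟩ := hus
  rw [inner_add_right, inner_smul_right, real_inner_self_eq_norm_sq] at huv
  have hpos : 0 < ‖w - v‖ := norm_pos_iff.2 (sub_ne_zero.2 hvw.symm)
  have : θ = 0 := by
    by_contra hne
    have := lt_of_le_of_ne h0 (Ne.symm hne)
    have : 0 < θ * ‖w - v‖ ^ 2 := by positivity
    linarith
  subst this
  simpa using hu.1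

theorem IsConvexPolyhedron.right_mem_vertices_of_adj {P : Set E3} (hP : IsConvexPolyhedron P)
    {v w : E3} (h : (graph P).Adj v w) : w ∈ vertices P :=
  hP.left_mem_vertices_of_adj h.symm

theorem IsConvexPolyhedron.exists_adj_of_mem_edge {P e : Set E3} (hP : IsConvexPolyhedron P)
    (he : e ∈ faces P 1) {v : E3} (hv : v ∈ vertices P) (hve : v ∈ e) :
    ∃ w, (graph P).Adj v w ∧ e = segment ℝ v w := by
  obtain ⟨a, b, hab, rfl, ha, hb, h⟩ := hP.exists_edge_ends he
  rcases h v hv hve with rfl | rfl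
  · exact ⟨b, he, rfl⟩
  · exact ⟨a, by rw [segment_symm] at he; exact he, segment_symm ℝ a v⟩

theorem IsConvexPolyhedron.eq_or_eq_of_mem_edge {P : Set E3} (hP : IsConvexPolyhedron P)
    {v w u : E3} (h : (graph P).Adj v w) (hu : u ∈ vertices P) (hue : u ∈ segment ℝ v w) :
    u = v ∨ u = w := by
  obtain ⟨a, b, hab, he, ha, hb, h'⟩ := hP.exists_edge_ends h
  have h1 := h' u hu hue
  have h2 := h' v (hP.left_mem_vertices_of_adj h) (left_mem_segment ℝ v w)
  have h3 := h' w (hP.right_mem_vertices_of_adj h) (right_mem_segment ℝ v w)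
  have h4 := h.ne
  grind

/-- A polyhedron is contained in the cone spanned at a vertex by its edges. -/
theorem IsConvexPolyhedron.mem_cone_of_mem {P : Set E3} (hP : IsConvexPolyhedron P) {v x : E3}
    (hv : v ∈ vertices P) (hx : x ∈ P) (hxv : x ≠ v) :
    ∃ t > (0 : ℝ), ∃ p ∈ convexHull ℝ {w | (graph P).Adj v w}, x = v + t • (p - v) := by
  obtain ⟨g, c, h, hxc⟩ := hP.exists_cutsOff hv hx hxv
  have hT := h.isConvexPolyhedron hP
  -- It is enough that the section cutting off `v` lies in this convex cone: the segment from `v` to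
  -- `x` meets the section, and each vertex of the section lies on an edge at `v`.
  set K : Set E3 := {y | ∃ t > (0 : ℝ), ∃ p ∈ convexHull ℝ {w | (graph P).Adj v w},
    y = v + t • (p - v)}
  have hKconv : Convex ℝ K := by
    rintro y ⟨t, ht, p, hp, rfl⟩ z ⟨s, hs, q, hq, rfl⟩ a b ha hb hab
    have hpos : 0 < a * t + b * s := by
      rcases ha.eq_or_lt with rfl | ha'
      · have : b = 1 := by linarith
        subst this
        simpa using hs
      · have := mul_pos ha' ht
        have := mul_nonneg hb hs.le
        linarith
    refine ⟨a * t + b * s, hpos, (a * t / (a * t + b * s)) • p + (b * s / (a * t + b * s)) • q,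
      convex_convexHull ℝ _ hp hq (by positivity) (by positivity) ?_, ?_⟩
    · rw [← add_div, div_self hpos.ne']
    · have hb' : b = 1 - a := by linarith
      have h1 : (a * t + b * s) • ((a * t / (a * t + b * s)) • p + (b * s / (a * t + b * s)) • q) =
          (a * t) • p + (b * s) • q := by
        rw [smul_add, smul_smul, smul_smul, mul_div_cancel₀ _ hpos.ne', mul_div_cancel₀ _ hpos.ne']
      rw [smul_sub (a * t + b * s), h1]
      subst hb'
      module
  have hsub : slice P g c ⊆ K := by
    rw [← hT.convexHull_vertices]
    refine convexHull_min (fun u hu => ?_) hKconv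
    obtain ⟨he, hve⟩ := h.minFace_mem_faces hP hu
    obtain ⟨w, hw, hew⟩ := hP.exists_adj_of_mem_edge he hv hve
    have hu' := vertices_subset hu
    have hus : u ∈ segment ℝ v w := hew ▸ self_mem_minFace hu'.1
    rw [segment_eq_image'] at hus
    obtain ⟨θ, ⟨h0, h1⟩, rfl⟩ := hus
    refine ⟨θ, lt_of_le_of_ne h0 ?_, w, subset_convexHull ℝ _ hw, rfl⟩
    rintro rfl
    have h1 := hu'.2
    have h2 := h.lt
    simp only [zero_smul, add_zero] at h1
    linarith
  have hvc := h.lt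
  have hpos : 0 < inner ℝ g v - inner ℝ g x := by linarith
  set θ := (inner ℝ g v - c) / (inner ℝ g v - inner ℝ g x) with hθ
  have hθ0 : 0 < θ := div_pos (by linarith) hpos
  have hθ1 : θ ≤ 1 := (div_le_one hpos).2 (by linarith)
  have hs : v + θ • (x - v) ∈ slice P g c := by
    refine ⟨hP.convex.add_smul_sub_mem (vertices_subset hv) hx ⟨hθ0.le, hθ1⟩, ?_⟩
    rw [inner_add_right, inner_smul_right, inner_sub_right,
      show inner ℝ g x - inner ℝ g v = -(inner ℝ g v - inner ℝ g x) by ring, mul_neg, hθ,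
      div_mul_cancel₀ _ hpos.ne']
    ring
  obtain ⟨t, ht, p, hp, hpt⟩ := hsub hs
  refine ⟨t / θ, by positivity, p, hp, ?_⟩
  have h1 : θ • (x - v) = t • (p - v) := add_left_cancel hpt
  rw [div_eq_inv_mul, ← smul_smul, ← h1, smul_smul, inv_mul_cancel₀ hθ0.ne']
  module

/-- A vertex that maximizes a linear functional among its neighbours maximizes it globally. -/
theorem IsConvexPolyhedron.inner_le_of_adj {P : Set E3} (hP : IsConvexPolyhedron P) {v g : E3}
    (hv : v ∈ vertices P) (h : ∀ w, (graph P).Adj v w → inner ℝ g w ≤ inner ℝ g v) :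
    ∀ x ∈ P, inner ℝ g x ≤ inner ℝ g v := by
  intro x hx
  rcases eq_or_ne x v with rfl | hxv
  · exact le_rfl
  obtain ⟨t, ht, p, hp, rfl⟩ := hP.mem_cone_of_mem hv hx hxv
  have hp' : inner ℝ g p ≤ inner ℝ g v := convexHull_min (fun w hw => h w hw) (convex_inner_le g _) hp
  rw [inner_add_right, inner_smul_right, inner_sub_right]
  nlinarith

/-- The graph of a polyhedron is connected. -/
theorem IsConvexPolyhedron.forall_vertices_of_adj {P : Set E3} (hP : IsConvexPolyhedron P)
    {Q : E3 → Prop} (hQ : ∀ u w, (graph P).Adj u w → Q u → Q w) {v : E3} (hv : v ∈ vertices P)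
    (hQv : Q v) : ∀ b ∈ vertices P, Q b := by
  intro b hb
  obtain ⟨g, β, hβ, he⟩ := exists_inner_of_isExposed (Set.singleton_nonempty b) hb.2.1
  -- Simplex argument: the highest vertex satisfying `Q`, for a functional exposing `b`, has no
  -- higher neighbour, hence is a global maximizer and equals `b`.
  obtain ⟨u, ⟨hu, hQu⟩, hmax⟩ := (hP.finite_vertices.subset (t := {u ∈ vertices P | Q u})
    fun u hu => hu.1).exists_maximalFor (fun u => inner ℝ g u) _ ⟨v, hv, hQv⟩
  have h1 : inner ℝ g b ≤ inner ℝ g u := by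
    refine hP.inner_le_of_adj hu (fun w hw => ?_) b (vertices_subset hb)
    by_contra hlt
    exact hlt (hmax ⟨hP.right_mem_vertices_of_adj hw, hQ u w hw hQu⟩ (not_le.1 hlt).le)
  have hbβ : b ∈ {x ∈ P | inner ℝ g x = β} := he ▸ Set.mem_singleton b
  have : u ∈ ({b} : Set E3) := by
    rw [he]
    exact ⟨vertices_subset hu, le_antisymm (hβ u (vertices_subset hu)) (hbβ.2 ▸ h1)⟩
  obtain rfl := Set.mem_singleton_iff.1 this
  exact hQu

/-- Any two edges at a vertex are linked by a chain of edges at this vertex in which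
consecutive edges lie in a common facet. -/
theorem IsConvexPolyhedron.forall_edges_at_vertex {P : Set E3} (hP : IsConvexPolyhedron P)
    {Q : Set E3 → Prop} {v : E3} (hv : v ∈ vertices P)
    (hQ : ∀ F ∈ faces P 2, ∀ e ∈ faces P 1, ∀ e' ∈ faces P 1, v ∈ e → v ∈ e' → e ⊆ F → e' ⊆ F →
      Q e → Q e') {e₀ : Set E3} (he₀ : e₀ ∈ faces P 1) (hve₀ : v ∈ e₀) (hQe₀ : Q e₀) :
    ∀ e ∈ faces P 1, v ∈ e → Q e := by
  intro e he hve
  obtain ⟨w, hw, hwe, hwv⟩ := hP.exists_vertex_ne he v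
  obtain ⟨g, c, h, -⟩ := hP.exists_cutsOff hv (vertices_subset hw) hwv
  have hT := h.isConvexPolyhedron hP
  obtain ⟨u₀, hu₀, -, rfl⟩ := h.exists_mem_vertices hP he₀ hve₀
  obtain ⟨u, hu, -, rfl⟩ := h.exists_mem_vertices hP he hve
  -- The chain is a path in the graph of the section cutting off `v`: its vertices are the edges at
  -- `v`, and its edges are the facets at `v`.
  refine hT.forall_vertices_of_adj (Q := fun u => Q (minFace P u)) (fun a b hab ha => ?_) hu₀ hQe₀
    u hu
  obtain ⟨F, ⟨hF, hvF⟩, hFab⟩ := (h.bijOn hP 1).surjOn hab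
  obtain ⟨h1, h2⟩ := h.minFace_mem_faces hP (hT.left_mem_vertices_of_adj hab)
  obtain ⟨h3, h4⟩ := h.minFace_mem_faces hP (hT.right_mem_vertices_of_adj hab)
  simp only at hFab
  have haF : a ∈ slice F g c := hFab ▸ left_mem_segment ℝ a b
  have hbF : b ∈ slice F g c := hFab ▸ right_mem_segment ℝ a b
  exact hQ F hF _ h1 _ h3 h2 h4 (minFace_subset_of_mem_faces hF haF.1)
    (minFace_subset_of_mem_faces hF hbF.1) ha

/-! ### Euler's formula by a sweeping plane. -/

/-- Some functional is nonzero on the finitely many differences of distinct points. It serves as a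
generic height for the sweep. -/
theorem exists_injOn_inner {V : Set E3} (hV : V.Finite) :
    ∃ g : E3, Set.InjOn (fun x => inner ℝ g x) V := by
  have : Finite V := hV
  obtain ⟨f, hf⟩ := Module.exists_dual_forall_apply_ne_zero (K := ℝ)
    (fun p : {p : V × V // p.1 ≠ p.2} => (p.1.1 : E3) - p.1.2)
    fun p => sub_ne_zero.2 fun h => p.2 (Subtype.ext h)
  refine ⟨(InnerProductSpace.toDual ℝ E3).symm (LinearMap.toContinuousLinearMap f), ?_⟩
  intro x hx y hy hxy
  by_contra hne
  refine hf ⟨(⟨x, hx⟩, ⟨y, hy⟩), fun h => hne (congrArg Subtype.val h)⟩ ?_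
  simpa [sub_eq_zero] using hxy

section Sweep

variable {P : Set E3} {g : E3}

/-- The `i`-faces of `P` on which `g` attains its minimum at `v`. -/
def bottomFaces (P : Set E3) (g : E3) (i : ℕ) (v : E3) : Set (Set E3) :=
  {F ∈ faces P i | v ∈ F ∧ ∀ y ∈ F, inner ℝ g v ≤ inner ℝ g y}

theorem IsConvexPolyhedron.exists_face_vertex_min (hP : IsConvexPolyhedron P) {F : Set E3} {i : ℕ}
    (hF : F ∈ faces P i) (g : E3) :
    ∃ u ∈ vertices P, u ∈ F ∧ ∀ y ∈ F, inner ℝ g u ≤ inner ℝ g y := by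
  obtain ⟨u, hu, h⟩ := (hP.of_isExposed hF.1 hF.2.1).exists_vertex_min hF.1 g
  rw [hP.vertices_of_face hF] at hu
  exact ⟨u, hu.1, hu.2, h⟩

theorem IsConvexPolyhedron.exists_face_vertex_max (hP : IsConvexPolyhedron P) {F : Set E3} {i : ℕ}
    (hF : F ∈ faces P i) (g : E3) :
    ∃ u ∈ vertices P, u ∈ F ∧ ∀ y ∈ F, inner ℝ g y ≤ inner ℝ g u := by
  obtain ⟨u, hu, h⟩ := (hP.of_isExposed hF.1 hF.2.1).exists_vertex_max hF.1 g
  rw [hP.vertices_of_face hF] at hu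
  exact ⟨u, hu.1, hu.2, h⟩

/-- A generic height has a unique lowest vertex on each face, so sorting faces by lowest vertex
counts each once. -/
theorem IsConvexPolyhedron.sum_ncard_bottomFaces (hP : IsConvexPolyhedron P)
    (hg : Set.InjOn (fun x => inner ℝ g x) (vertices P)) (i : ℕ) :
    ∑ v ∈ hP.finite_vertices.toFinset, (bottomFaces P g i v).ncard = (faces P i).ncard := by
  classical
  have h := Finset.sum_card_bipartiteAbove_eq_sum_card_bipartiteBelow
    (s := hP.finite_vertices.toFinset) (t := (hP.finite_faces i).toFinset)
    (fun v F => v ∈ F ∧ ∀ y ∈ F, inner ℝ g v ≤ inner ℝ g y)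
  rw [Set.ncard_eq_toFinset_card _ (hP.finite_faces i), Finset.card_eq_sum_ones]
  refine Eq.trans (Finset.sum_congr rfl fun v _ => ?_) (h.trans (Finset.sum_congr rfl fun F hF => ?_))
  · rw [← Set.ncard_coe_finset, Finset.coe_bipartiteAbove]
    simp only [Set.Finite.mem_toFinset]
    rfl
  · rw [Set.Finite.mem_toFinset] at hF
    obtain ⟨u, hu, huF, hmin⟩ := hP.exists_face_vertex_min hF g
    rw [Finset.card_eq_one]
    refine ⟨u, Finset.ext fun w => ?_⟩
    simp only [Finset.mem_bipartiteBelow, Set.Finite.mem_toFinset, Finset.mem_singleton]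
    constructor
    · rintro ⟨hw, hwF, hw'⟩
      exact hg hw hu (le_antisymm (hw' u huF) (hmin w hwF))
    · rintro rfl
      exact ⟨hu, huF, hmin⟩

/-- A hyperplane that crosses a three-dimensional polyhedron, and contains no edge, crosses as
many facets as it crosses edges and contains vertices. -/
theorem IsConvexPolyhedron.ncard_crosses (hP : IsConvexPolyhedron P)
    (hd : Module.finrank ℝ (vectorSpan ℝ P) = 3)
    (hg : Set.InjOn (fun x => inner ℝ g x) (vertices P)) {c : ℝ} (hc : Crosses g c P) :
    {F ∈ faces P 2 | Crosses g c F}.ncard =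
      {F ∈ faces P 1 | Crosses g c F}.ncard + {v ∈ vertices P | inner ℝ g v = c}.ncard := by
  have hg0 : g ≠ 0 := by
    rintro rfl
    obtain ⟨⟨y, -, hy⟩, z, -, hz⟩ := hc
    rw [inner_zero_left] at hy hz
    exact hy.asymm hz
  have hT : IsConvexPolyhedron (slice P g c) := hP.inter_hyperplane hg0 c
  have hne : P.Nonempty := let ⟨⟨y, hy, _⟩, _⟩ := hc; ⟨y, hy⟩
  have hTd : Module.finrank ℝ (vectorSpan ℝ (slice P g c)) = 2 :=
    ((hP.bijOn_slice hg0 c 2).mapsTo (Or.inl ⟨⟨hne, IsExposed.refl P, hd⟩, hc⟩)).2.2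
  -- The section is a polygon. Its edges are sections of crossed facets; its vertices are sections
  -- of crossed edges or vertices of `P` in the plane.
  have h := hT.ncard_edges_eq hTd
  rw [← (hP.bijOn_slice hg0 c 0).ncard_eq, ← (hP.bijOn_slice hg0 c 1).ncard_eq] at h
  have h1 : {F ∈ faces P 1 | ∀ y ∈ F, inner ℝ g y = c} = ∅ := by
    refine Set.eq_empty_of_forall_notMem fun F hF => ?_
    obtain ⟨u, hu, huF⟩ := hP.exists_vertex_mem hF.1
    obtain ⟨w, hw, hwF, hwu⟩ := hP.exists_vertex_ne hF.1 u
    exact hwu (hg hw hu ((hF.2 w hwF).trans (hF.2 u huF).symm))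
  have h0 : {F ∈ faces P 0 | ∀ y ∈ F, inner ℝ g y = c} =
      (fun v => ({v} : Set E3)) '' {v ∈ vertices P | inner ℝ g v = c} := by
    ext F
    simp only [Set.mem_ofPred_eq, mem_faces_zero_iff, Set.mem_image]
    constructor
    · rintro ⟨⟨v, hv, rfl⟩, h⟩
      exact ⟨v, ⟨hv, h v rfl⟩, rfl⟩
    · rintro ⟨v, ⟨hv, h⟩, rfl⟩
      exact ⟨⟨v, hv, rfl⟩, by rintro y rfl; exact h⟩
  rw [h1, Set.union_empty] at h
  rw [h, Set.ncard_union_eq _ ((hP.finite_faces 1).subset fun F hF => hF.1)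
    ((hP.finite_faces 0).subset fun F hF => hF.1), h0,
    Set.ncard_image_of_injective _ Set.singleton_injective]
  rw [Set.disjoint_left]
  rintro F ⟨-, ⟨y, hy, hyc⟩, -⟩ ⟨-, hF⟩
  exact hyc.ne (hF y hy)

/-- When the plane rises from `v` to a level below the next vertex, no crossed face is lost, and the
new ones are those whose lowest vertex is `v`. -/
theorem IsConvexPolyhedron.ncard_crosses_above (hP : IsConvexPolyhedron P)
    (hg : Set.InjOn (fun x => inner ℝ g x) (vertices P)) {v : E3} (hv : v ∈ vertices P) {c : ℝ}
    (hc : inner ℝ g v < c) (hc' : ∀ u ∈ vertices P, inner ℝ g v < inner ℝ g u → c < inner ℝ g u)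
    (j : ℕ) : {F ∈ faces P (j + 1) | Crosses g c F}.ncard =
      {F ∈ faces P (j + 1) | Crosses g (inner ℝ g v) F}.ncard +
        (bottomFaces P g (j + 1) v).ncard := by
  rw [← Set.ncard_union_eq _ ((hP.finite_faces _).subset fun F hF => hF.1)
    ((hP.finite_faces _).subset fun F hF => hF.1)]
  · congr 1
    ext F
    constructor
    · rintro ⟨hF, ⟨y, hy, hyc⟩, z, hz, hzc⟩
      obtain ⟨u, hu, huF, hmin⟩ := hP.exists_face_vertex_min hF g
      have huc := (hmin y hy).trans_lt hyc
      rcases lt_trichotomy (inner ℝ g u) (inner ℝ g v) with h | h | h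
      · exact Or.inl ⟨hF, ⟨u, huF, h⟩, z, hz, hc.trans hzc⟩
      · obtain rfl := hg hu hv h
        exact Or.inr ⟨hF, huF, hmin⟩
      · exact absurd huc (hc' u hu h).not_gt
    · rintro (⟨hF, ⟨y, hy, hyc⟩, z, hz, hzc⟩ | ⟨hF, hvF, hmin⟩)
      · obtain ⟨u, hu, huF, hmax⟩ := hP.exists_face_vertex_max hF g
        exact ⟨hF, ⟨y, hy, hyc.trans hc⟩, u, huF, hc' u hu (hzc.trans_le (hmax z hz))⟩
      · obtain ⟨u, hu, huF, huv⟩ := hP.exists_vertex_ne hF v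
        exact ⟨hF, ⟨v, hvF, hc⟩, u, huF, hc' u hu
          (lt_of_le_of_ne (hmin u huF) fun h => huv (hg hu hv h.symm))⟩
  · rw [Set.disjoint_left]
    rintro F ⟨-, ⟨y, hy, hyc⟩, -⟩ ⟨-, -, hF⟩
    exact hyc.not_ge (hF y hy)

end Sweep

/-- The polyhedron formula of Euler. -/
theorem IsConvexPolyhedron.euler {P : Set E3} (hP : IsConvexPolyhedron P)
    (hd : Module.finrank ℝ (vectorSpan ℝ P) = 3) :
    fNumber P 1 + 2 = fNumber P 2 + fNumber P 0 := by
  classical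
  have hne : P.Nonempty := by
    by_contra h
    rw [Set.not_nonempty_iff_eq_empty] at h
    rw [h, vectorSpan_empty, finrank_bot] at hd
    omega
  have hPP : P ∈ faces P (2 + 1) := ⟨hne, IsExposed.refl P, hd⟩
  obtain ⟨g, hg⟩ := exists_injOn_inner hP.finite_vertices
  obtain ⟨bot, hbot, hmin⟩ := hP.exists_vertex_min hne g
  obtain ⟨top, htop, hmax⟩ := hP.exists_vertex_max hne g
  have hlt : ∀ v ∈ vertices P, v ≠ top → inner ℝ g v < inner ℝ g top := fun v hv h =>
    lt_of_le_of_ne (hmax v (vertices_subset hv)) fun h' => h (hg hv htop h')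
  have hgt : ∀ v ∈ vertices P, v ≠ bot → inner ℝ g bot < inner ℝ g v := fun v hv h =>
    lt_of_le_of_ne (hmin v (vertices_subset hv)) fun h' => h (hg hbot hv h').symm
  have hbt : bot ≠ top := by
    rintro rfl
    obtain ⟨u, hu, -, hub⟩ := hP.exists_vertex_ne hPP bot
    exact (hlt u hu hub).not_ge (hmin u (vertices_subset hu))
  -- Local form of Euler's formula: comparing the polygons at and just above `v`, one more edge than
  -- facets starts at `v`. At `bot` the numbers agree and at `top` both are zero; these two
  -- exceptions give the 2.
  have key : ∀ v ∈ hP.finite_vertices.toFinset,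
      (bottomFaces P g 1 v).ncard + ((if v = top then 1 else 0) + if v = bot then 1 else 0) =
        (bottomFaces P g 2 v).ncard + 1 := by
    intro v hv
    rw [Set.Finite.mem_toFinset] at hv
    by_cases hvt : v = top
    · subst hvt
      have hemp : ∀ j, bottomFaces P g (j + 1) v = ∅ := fun j => by
        refine Set.eq_empty_of_forall_notMem fun F hF => ?_
        obtain ⟨u, hu, huF, huv⟩ := hP.exists_vertex_ne hF.1 v
        exact (hlt u hu huv).not_ge (hF.2.2 u huF)
      rw [hemp 0, hemp 1, if_pos rfl, if_neg hbt.symm]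
    -- Heights are negated because the lemma supplies a level below a bound, while a level just
    -- above `v`, namely `-c'`, is needed.
    · obtain ⟨c', hc', hgap⟩ := exists_between_of_finite (f := fun u => -inner ℝ g u)
        (b := -inner ℝ g v) (s := {u ∈ vertices P | inner ℝ g v < inner ℝ g u})
        (hP.finite_vertices.subset fun u hu => hu.1) fun u hu => neg_lt_neg hu.2
      have hc : inner ℝ g v < -c' := by linarith
      have hgap' : ∀ u ∈ vertices P, inner ℝ g v < inner ℝ g u → -c' < inner ℝ g u :=
        fun u hu h => by
          have := hgap u ⟨hu, h⟩
          linarith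
      have e1 := hP.ncard_crosses_above hg hv hc hgap' 0
      have e2 := hP.ncard_crosses_above hg hv hc hgap' 1
      have e3 := hP.ncard_crosses hd hg (c := -c')
        ⟨⟨v, vertices_subset hv, hc⟩, top, vertices_subset htop, hgap' top htop (hlt v hv hvt)⟩
      have e4 : {u ∈ vertices P | inner ℝ g u = -c'} = ∅ := by
        refine Set.eq_empty_of_forall_notMem fun u hu => ?_
        have h1 := hgap' u hu.1
        have h2 := hu.2
        rw [h2] at h1
        exact lt_irrefl _ (h1 hc)
      rw [e4, Set.ncard_empty] at e3
      rw [if_neg hvt]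
      by_cases hvb : v = bot
      · subst hvb
        have hemp : ∀ i, {F ∈ faces P i | Crosses g (inner ℝ g v) F} = ∅ := fun i => by
          refine Set.eq_empty_of_forall_notMem fun F hF => ?_
          obtain ⟨hF, ⟨y, hy, hyc⟩, -⟩ := hF
          exact hyc.not_ge (hmin y (subset_of_mem_faces hF hy))
        rw [hemp, Set.ncard_empty] at e1 e2
        rw [if_pos rfl]
        simp only [zero_add, Nat.reduceAdd] at *
        omega
      · have e5 := hP.ncard_crosses hd hg (c := inner ℝ g v)
          ⟨⟨bot, vertices_subset hbot, hgt v hv hvb⟩, top, vertices_subset htop, hlt v hv hvt⟩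
        have e6 : {u ∈ vertices P | inner ℝ g u = inner ℝ g v} = {v} := by
          ext u
          exact ⟨fun hu => hg hu.1 hv hu.2, by rintro rfl; exact ⟨hv, rfl⟩⟩
        rw [e6, Set.ncard_singleton] at e5
        rw [if_neg hvb]
        simp only [zero_add, Nat.reduceAdd] at *
        omega
  have hsum := Finset.sum_congr rfl key
  rw [Finset.sum_add_distrib, Finset.sum_add_distrib, Finset.sum_add_distrib,
    hP.sum_ncard_bottomFaces hg, hP.sum_ncard_bottomFaces hg, Finset.sum_ite_eq',
    Finset.sum_ite_eq', if_pos (by simpa using htop), if_pos (by simpa using hbot),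
    ← Finset.card_eq_sum_ones, ← Set.ncard_eq_toFinset_card _ hP.finite_vertices] at hsum
  rw [fNumber_zero]
  simpa [fNumber] using hsum

/-! ### Dimension, facets and defining constraints. -/

theorem nonempty_of_finrank {P : Set E3} {d : ℕ}
    (hd : Module.finrank ℝ (vectorSpan ℝ P) = d + 1) : P.Nonempty := by
  by_contra h
  rw [Set.not_nonempty_iff_eq_empty] at h
  rw [h, vectorSpan_empty, finrank_bot] at hd
  omega

theorem finrank_vectorSpan_le_two {F : Set E3} {g : E3} {b : ℝ} (hg : g ≠ 0)
    (h : ∀ x ∈ F, inner ℝ g x = b) : Module.finrank ℝ (vectorSpan ℝ F) ≤ 2 := by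
  have hle : vectorSpan ℝ F ≤ ⊤ ⊓ LinearMap.ker (innerₛₗ ℝ g) := by
    rw [top_inf_eq, vectorSpan_def, Submodule.span_le]
    rintro _ ⟨x, hx, y, hy, rfl⟩
    simp [inner_sub_right, h x hx, h y hy]
  have h1 := Submodule.finrank_mono hle
  have h2 := finrank_inf_ker_add_one (V := ⊤) (g := g) (d := g) trivial (by
    rw [real_inner_self_eq_norm_sq]
    have := norm_pos_iff.2 hg
    positivity)
  rw [finrank_top, finrank_euclideanSpace_fin] at h2
  omega

theorem ne_zero_of_face {P : Set E3} {g : E3} {b : ℝ} {d i : ℕ}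
    (hd : Module.finrank ℝ (vectorSpan ℝ P) = d) (hF : {x ∈ P | inner ℝ g x = b} ∈ faces P i)
    (hi : i ≠ d) : g ≠ 0 := by
  rintro rfl
  obtain ⟨w, hw, hw'⟩ := hF.1
  rw [inner_zero_left] at hw'
  refine hi (hF.2.2.symm.trans (Eq.trans ?_ hd))
  congr 3
  all_goals
    ext x
    simp [hw'.symm]

/-- A facet of a three-dimensional polyhedron is cut out by one of the defining constraints. -/
theorem exists_constraint_of_facet {P : Set E3} {H : Set (E3 × ℝ)} (hP : IsConvexPolyhedron P)
    (hf : H.Finite) (h0 : ∀ h ∈ H, h.1 ≠ 0) (hPH : P = {x | ∀ h ∈ H, inner ℝ h.1 x ≤ h.2})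
    (hd : Module.finrank ℝ (vectorSpan ℝ P) = 3) {F : Set E3} (hF : F ∈ faces P 2) :
    ∃ h ∈ H, F = {x ∈ P | inner ℝ h.1 x = h.2} := by
  obtain ⟨x, hx, rfl, hi⟩ := hP.mem_faces_iff.1 hF
  have hmin : minFace P x = {y | y ∈ P ∧ ∀ h ∈ active H x, inner ℝ h.1 y = h.2} := by
    subst hPH
    exact minFace_eq_active hf hx
  have hne : (active H x).Nonempty := by
    rw [Set.nonempty_iff_ne_empty]
    intro he
    rw [he] at hmin
    simp only [Set.mem_empty_iff_false, false_imp_iff, implies_true, and_true] at hmin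
    have : minFace P x = P := hmin
    rw [this] at hi
    omega
  obtain ⟨h, hh⟩ := hne
  refine ⟨h, hh.1, hP.face_eq_of_subset hF ?_ fun y hy => ?_⟩
  · refine ⟨⟨x, hx, hh.2⟩, isExposed_of_inner fun y hy => ?_,
      le_antisymm (finrank_vectorSpan_le_two (h0 h hh.1) fun y hy => hy.2) ?_⟩
    · rw [hPH] at hy
      exact hy h hh.1
    · rw [← hi]
      refine Submodule.finrank_mono (vectorSpan_mono ℝ fun y hy => ?_)
      rw [hmin] at hy
      exact ⟨hy.1, hy.2 h hh⟩
  · rw [hmin] at hy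
    exact ⟨hy.1, hy.2 h hh⟩

theorem finrank_of_strict {P : Set E3} {H : Set (E3 × ℝ)} (hf : H.Finite)
    (hPH : P = {x | ∀ h ∈ H, inner ℝ h.1 x ≤ h.2}) {c : E3} (hc : ∀ h ∈ H, inner ℝ h.1 c < h.2) :
    Module.finrank ℝ (vectorSpan ℝ P) = 3 := by
  have htop : vectorSpan ℝ P = ⊤ := by
    refine eq_top_iff.2 fun y _ => ?_
    obtain ⟨ε, hε, h⟩ := exists_add_smul_mem hf (x := c) (y := y) (fun h hh => (hc h hh).le)
      fun h hh => absurd hh.2 (hc h hh.1).ne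
    have h1 : c + ε • y ∈ P := by rw [hPH]; exact h
    have h2 : c ∈ P := by rw [hPH]; exact fun h hh => (hc h hh).le
    have h3 := Submodule.smul_mem _ ε⁻¹ (vsub_mem_vectorSpan ℝ h1 h2)
    rwa [vsub_eq_sub, add_sub_cancel_left, smul_smul, inv_mul_cancel₀ hε.ne', one_smul] at h3
  rw [htop, finrank_top, finrank_euclideanSpace_fin]

/-! ### Semiregular polyhedra are inscribed and equilateral. -/

/-- A three-dimensional polyhedron with all vertices at distance `r` from the point `c` in its
interior, and with all edges of length `l`. -/
structure IsInscribedEquilateral (P : Set E3) (c : E3) (r l : ℝ) : Prop where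
  polyhedron : IsConvexPolyhedron P
  dim_eq : Module.finrank ℝ (vectorSpan ℝ P) = 3
  norm_sub_center : ∀ v ∈ vertices P, ‖v - c‖ = r
  norm_sub_of_adj : ∀ v w, (graph P).Adj v w → ‖v - w‖ = l
  inner_center_lt : ∀ (g : E3) (b : ℝ), g ≠ 0 → (∀ y ∈ P, inner ℝ g y ≤ b) → inner ℝ g c < b

theorem IsConvexPolyhedron.map_mem_vertices {P : Set E3} (hP : IsConvexPolyhedron P)
    (φ : E3 ≃ᵃⁱ[ℝ] E3) (hφ : φ '' P = P) {v : E3} (hv : v ∈ vertices P) : φ v ∈ vertices P := by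
  have hvP := vertices_subset hv
  have hφv : φ v ∈ P := hφ ▸ Set.mem_image_of_mem φ hvP
  refine hP.mem_vertices_iff.2 ⟨hφv, Set.Subset.antisymm ?_
    (Set.singleton_subset_iff.2 (self_mem_minFace hφv))⟩
  rintro y ⟨hy, ε, hε, hz⟩
  rw [← hφ] at hy hz
  obtain ⟨y, hy, rfl⟩ := hy
  obtain ⟨z, hz, hz'⟩ := hz
  have hline : φ (v + ε • (v - y)) = φ v + ε • (φ v - φ y) := by
    have h := φ.toAffineEquiv.toAffineMap.apply_lineMap v y (-ε)
    simp only [AffineMap.lineMap_apply, vsub_eq_sub, vadd_eq_add] at h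
    have e1 : -ε • (y - v) + v = v + ε • (v - y) := by module
    have e2 : ∀ a b : E3, -ε • (b - a) + a = a + ε • (a - b) := fun a b => by module
    rw [e1, e2] at h
    exact h
  have hzy : z = v + ε • (v - y) := φ.injective (hz'.trans hline.symm)
  have hmem : y ∈ minFace P v := ⟨hy, ε, hε, hzy ▸ hz⟩
  rw [(hP.mem_vertices_iff.1 hv).2] at hmem
  obtain rfl := Set.mem_singleton_iff.1 hmem
  rfl

/-- The centroid of the vertices of `P`. -/
def centroid (P : Set E3) : E3 := ((vertices P).ncard : ℝ)⁻¹ • ∑ᶠ v ∈ vertices P, v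

/-- A symmetry permutes the vertices, and affine maps preserve means. -/
theorem IsConvexPolyhedron.map_centroid {P : Set E3} (hP : IsConvexPolyhedron P)
    (hne : P.Nonempty) (φ : E3 ≃ᵃⁱ[ℝ] E3) (hφ : φ '' P = P) : φ (centroid P) = centroid P := by
  have hfin := hP.finite_vertices
  have hn : ((vertices P).ncard : ℝ) ≠ 0 := by
    rw [Nat.cast_ne_zero, ← pos_iff_ne_zero, Set.ncard_pos hfin]
    exact hP.nonempty_vertices hne
  have hmaps : Set.MapsTo φ (vertices P) (vertices P) := fun v hv => hP.map_mem_vertices φ hφ hv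
  have hbij : Set.BijOn φ (vertices P) (vertices P) := by
    refine ⟨hmaps, φ.injective.injOn, ?_⟩
    exact (Set.eq_of_subset_of_ncard_le hmaps.image_subset
      (Set.ncard_image_of_injective _ φ.injective).ge hfin).ge
  obtain ⟨b, hdec⟩ : ∃ b, ∀ x, φ x = φ.linearIsometryEquiv x + b := ⟨φ 0, fun x => by
    have := φ.map_vadd 0 x
    simpa using this⟩
  have hsum : ∑ᶠ v ∈ vertices P, φ v = ∑ᶠ v ∈ vertices P, v :=
    finsum_mem_eq_of_bijOn φ hbij fun _ _ => rfl
  rw [finsum_mem_eq_finite_toFinset_sum _ hfin, finsum_mem_eq_finite_toFinset_sum _ hfin] at hsum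
  rw [centroid, hdec, map_smul, finsum_mem_eq_finite_toFinset_sum _ hfin, map_sum]
  simp only [hdec] at hsum
  rw [Finset.sum_add_distrib, Finset.sum_const, ← Set.ncard_eq_toFinset_card _ hfin] at hsum
  rw [← hsum, smul_add, ← Nat.cast_smul_eq_nsmul ℝ, smul_smul, inv_mul_cancel₀ hn, one_smul]

/-- Equality would force every vertex onto the supporting plane, and with them all of `P`. -/
theorem IsConvexPolyhedron.inner_centroid_lt {P : Set E3} (hP : IsConvexPolyhedron P)
    (hd : Module.finrank ℝ (vectorSpan ℝ P) = 3) {g : E3} {b : ℝ} (hg : g ≠ 0)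
    (hb : ∀ y ∈ P, inner ℝ g y ≤ b) : inner ℝ g (centroid P) < b := by
  have hfin := hP.finite_vertices
  have hne := nonempty_of_finrank hd
  have hn : (0 : ℝ) < (vertices P).ncard := by
    rw [Nat.cast_pos, Set.ncard_pos hfin]
    exact hP.nonempty_vertices hne
  have hlt : ∃ v ∈ vertices P, inner ℝ g v < b := by
    by_contra! h
    have h' : ∀ x ∈ P, inner ℝ g x = b := fun x hx => by
      refine le_antisymm (hb x hx) ?_
      have := hP.inner_le_of_vertices (g := -g) (c := -b)
        (fun u hu => by simpa using h u hu) x hx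
      simpa using this
    have := finrank_vectorSpan_le_two hg h'
    omega
  rw [centroid, inner_smul_right, finsum_mem_eq_finite_toFinset_sum _ hfin, inner_sum,
    inv_mul_lt_iff₀ hn]
  calc ∑ v ∈ hfin.toFinset, inner ℝ g v < ∑ v ∈ hfin.toFinset, b := by
        obtain ⟨v, hv, hvb⟩ := hlt
        exact Finset.sum_lt_sum (fun u hu => hb u (vertices_subset (by simpa using hu)))
          ⟨v, by simpa using hv, hvb⟩
    _ = _ := by rw [Finset.sum_const, ← Set.ncard_eq_toFinset_card _ hfin, nsmul_eq_mul]

theorem IsConvexPolyhedron.exists_adj {P : Set E3} (hP : IsConvexPolyhedron P) {d : ℕ}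
    (hd : Module.finrank ℝ (vectorSpan ℝ P) = d + 1) {v : E3} (hv : v ∈ vertices P) :
    ∃ w, (graph P).Adj v w := by
  obtain ⟨u, hu, -, huv⟩ := hP.exists_vertex_ne ⟨nonempty_of_finrank hd, IsExposed.refl P, hd⟩ v
  obtain ⟨t, ht, p, hp, -⟩ := hP.mem_cone_of_mem hv (vertices_subset hu) huv
  exact convexHull_nonempty_iff.1 ⟨p, hp⟩

/-- Symmetries fix the centroid and are transitive on vertices, whence the common radius. Edges at a
vertex are linked through common regular facets, so they have equal length, and connectedness of the
graph spreads this length. -/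
theorem IsSemiregular.exists_isInscribedEquilateral {P : Set E3} (h : IsSemiregular P) :
    ∃ r l, IsInscribedEquilateral P (centroid P) r l := by
  have hP := h.polyhedron
  have hne := nonempty_of_finrank h.dim_eq
  obtain ⟨v₀, hv₀⟩ := hP.nonempty_vertices hne
  obtain ⟨w₀, hw₀⟩ := hP.exists_adj h.dim_eq hv₀
  have hlocal : ∀ v w w', (graph P).Adj v w → (graph P).Adj v w' → dist v w = dist v w' := by
    intro v w w' hw hw'
    have hv := hP.left_mem_vertices_of_adj hw
    -- The predicate must depend on the edge as a set, so it quantifies over every possible second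
    -- end `u`.
    refine (hP.forall_edges_at_vertex (Q := fun e => ∀ u, e = segment ℝ v u → dist v w = dist v u)
      hv ?_ hw (left_mem_segment ℝ v w) ?_ (segment ℝ v w') hw' (left_mem_segment ℝ v w')) w' rfl
    · rintro F hF e he e' he' hve hve' heF heF' hQ u rfl
      obtain ⟨u', hu', rfl⟩ := hP.exists_adj_of_mem_edge he hv hve
      rw [hQ u' rfl]
      refine (h.regular_faces F hF).equilateral v u' v u ?_ ?_
      · change _ ∈ faces F 1
        rw [hP.faces_of_face hF]
        exact ⟨he, heF⟩
      · change _ ∈ faces F 1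
        rw [hP.faces_of_face hF]
        exact ⟨he', heF'⟩
    · intro u hu
      have hadj : (graph P).Adj v u := by
        change segment ℝ v u ∈ faces P 1
        rw [← hu]
        exact hw
      rcases hP.eq_or_eq_of_mem_edge hadj (hP.right_mem_vertices_of_adj hw)
        (hu ▸ right_mem_segment ℝ v w) with h' | h'
      · exact absurd h'.symm hw.ne
      · rw [h']
  have hglobal : ∀ v ∈ vertices P, ∀ w, (graph P).Adj v w → dist v w = dist v₀ w₀ :=
    hP.forall_vertices_of_adj (Q := fun v => ∀ w, (graph P).Adj v w → dist v w = dist v₀ w₀)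
      (fun u w huw hu w' hw' => by
        rw [← hlocal w u w' huw.symm hw', dist_comm, hu w huw]) hv₀
      fun w hw => hlocal v₀ w w₀ hw hw₀
  refine ⟨dist v₀ (centroid P), dist v₀ w₀, hP, h.dim_eq, fun v hv => ?_, fun v w hvw => ?_,
    fun g b hg hb => hP.inner_centroid_lt h.dim_eq hg hb⟩
  · obtain ⟨φ, hφ, hφv⟩ := h.vertex_transitive v₀ hv₀ v hv
    rw [← dist_eq_norm, ← hφv]
    conv_lhs => rw [← hP.map_centroid hne φ hφ]
    exact φ.dist_map _ _
  · rw [← dist_eq_norm]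
    exact hglobal v (hP.left_mem_vertices_of_adj hvw) w hvw

/-! ### Half-spaces about a center and edge midpoints. -/

theorem convex_inner_sub_le (g c : E3) (k : ℝ) : Convex ℝ {x : E3 | inner ℝ g (x - c) ≤ k} := by
  convert convex_inner_le g (k + inner ℝ g c) using 3
  rw [inner_sub_right, sub_le_iff_le_add]

theorem convex_le_inner_sub (g c : E3) (k : ℝ) : Convex ℝ {x : E3 | k ≤ inner ℝ g (x - c)} := by
  convert convex_inner_sub_le (-g) c (-k) using 3
  rw [inner_neg_left, neg_le_neg_iff]

theorem inner_midpoint_sub (g a b c : E3) :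
    inner ℝ g (midpoint ℝ a b - c) = (inner ℝ g (a - c) + inner ℝ g (b - c)) / 2 := by
  have : midpoint ℝ a b - c = (1 / 2 : ℝ) • ((a - c) + (b - c)) := by
    rw [midpoint_eq_smul_add, invOf_eq_inv]
    module
  rw [this, inner_smul_right, inner_add_right]
  ring

theorem convex_eq_inner_sub (g c : E3) (k : ℝ) : Convex ℝ {x : E3 | inner ℝ g (x - c) = k} := by
  convert (convex_inner_sub_le g c k).inter (convex_le_inner_sub g c k) using 1
  ext x
  exact le_antisymm_iff

/-- The midpoints of the edges of `P`. -/
def edgeMidpoints (P : Set E3) : Set E3 := {m | ∃ v w, (graph P).Adj v w ∧ m = midpoint ℝ v w}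

theorem IsConvexPolyhedron.midpoint_mem {P : Set E3} (hP : IsConvexPolyhedron P) {v w : E3}
    (h : (graph P).Adj v w) : midpoint ℝ v w ∈ P :=
  hP.convex.midpoint_mem (vertices_subset (hP.left_mem_vertices_of_adj h))
    (vertices_subset (hP.right_mem_vertices_of_adj h))

theorem IsConvexPolyhedron.rectify_subset {P : Set E3} (hP : IsConvexPolyhedron P) :
    rectify P ⊆ P := by
  refine convexHull_min ?_ hP.convex
  rintro m ⟨v, w, h, rfl⟩
  exact hP.midpoint_mem h

/-- The midpoint of an edge lies in the relative interior of the edge. -/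
theorem IsConvexPolyhedron.minFace_midpoint {P : Set E3} (hP : IsConvexPolyhedron P) {v w : E3}
    (h : (graph P).Adj v w) : minFace P (midpoint ℝ v w) = segment ℝ v w := by
  have hv := vertices_subset (hP.left_mem_vertices_of_adj h)
  have hw := vertices_subset (hP.right_mem_vertices_of_adj h)
  have hm := hP.midpoint_mem h
  have ho : midpoint ℝ v w ∈ openSegment ℝ v w :=
    ⟨1 / 2, 1 / 2, by norm_num, by norm_num, by norm_num, by
      rw [midpoint_eq_smul_add, invOf_eq_inv]
      module⟩
  refine Set.Subset.antisymm (minFace_subset_of_mem_faces h (openSegment_subset_segment ℝ v w ho)) ?_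
  exact ((hP.isExposed_minFace hm).convex hP.convex).segment_subset
    (left_mem_minFace_of_mem_openSegment hv hw ho) (right_mem_minFace_of_mem_openSegment hv hw ho)

theorem IsConvexPolyhedron.minFace_mem_of_mem_edgeMidpoints {P : Set E3}
    (hP : IsConvexPolyhedron P) {m : E3} (hm : m ∈ edgeMidpoints P) :
    m ∈ P ∧ minFace P m ∈ faces P 1 := by
  obtain ⟨v, w, h, rfl⟩ := hm
  exact ⟨hP.midpoint_mem h, hP.minFace_midpoint h ▸ h⟩

/-- An edge is recovered from its midpoint as the minimal face, so vertices of the rectification can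
be traded for edges of `P`. -/
theorem IsConvexPolyhedron.bijOn_edgeMidpoints {P : Set E3} (hP : IsConvexPolyhedron P) :
    Set.BijOn (minFace P) (edgeMidpoints P) (faces P 1) := by
  refine ⟨fun m hm => (hP.minFace_mem_of_mem_edgeMidpoints hm).2, ?_, ?_⟩
  · rintro _ ⟨v, w, h, rfl⟩ _ ⟨v', w', h', rfl⟩ he
    rw [hP.minFace_midpoint h, hP.minFace_midpoint h'] at he
    have h1 := hP.eq_or_eq_of_mem_edge h (hP.left_mem_vertices_of_adj h')
      (he ▸ left_mem_segment ℝ v' w')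
    have h2 := hP.eq_or_eq_of_mem_edge h (hP.right_mem_vertices_of_adj h')
      (he ▸ right_mem_segment ℝ v' w')
    have h3 := h'.ne
    rcases h1 with rfl | rfl <;> rcases h2 with rfl | rfl
    · exact absurd rfl h3
    · rfl
    · exact midpoint_comm _ _
    · exact absurd rfl h3
  · intro e he
    obtain ⟨a, b, hab, rfl, -⟩ := hP.exists_edge_ends he
    exact ⟨midpoint ℝ a b, ⟨a, b, he, rfl⟩, hP.minFace_midpoint he⟩

theorem IsConvexPolyhedron.finite_edgeMidpoints {P : Set E3} (hP : IsConvexPolyhedron P) :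
    (edgeMidpoints P).Finite :=
  (hP.finite_faces 1).of_injOn hP.bijOn_edgeMidpoints.mapsTo hP.bijOn_edgeMidpoints.injOn

/-! ### Rectification as truncation by planes. -/

namespace IsInscribedEquilateral

variable {P : Set E3} {c : E3} {r l : ℝ}

theorem inner_self (h : IsInscribedEquilateral P c r l) {v : E3} (hv : v ∈ vertices P) :
    inner ℝ (v - c) (v - c) = r ^ 2 := by
  rw [real_inner_self_eq_norm_sq, h.norm_sub_center v hv]

/-- By the law of cosines, so all neighbours of `v` lie in one plane orthogonal to `v - c`. -/
theorem inner_adj (h : IsInscribedEquilateral P c r l) {v w : E3} (hvw : (graph P).Adj v w) :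
    inner ℝ (v - c) (w - c) = r ^ 2 - l ^ 2 / 2 := by
  have h1 := norm_sub_sq_real (v - c) (w - c)
  rw [sub_sub_sub_cancel_right, h.norm_sub_of_adj v w hvw,
    h.norm_sub_center v (h.polyhedron.left_mem_vertices_of_adj hvw),
    h.norm_sub_center w (h.polyhedron.right_mem_vertices_of_adj hvw)] at h1
  linarith

theorem exists_adj (h : IsInscribedEquilateral P c r l) : ∃ v w, (graph P).Adj v w := by
  obtain ⟨v, hv⟩ := h.polyhedron.nonempty_vertices (nonempty_of_finrank h.dim_eq)
  exact ⟨v, h.polyhedron.exists_adj h.dim_eq hv⟩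

theorem length_sq_pos (h : IsInscribedEquilateral P c r l) : 0 < l ^ 2 := by
  obtain ⟨v, w, hvw⟩ := h.exists_adj
  have h1 := norm_pos_iff.2 (sub_ne_zero.2 hvw.ne)
  rw [h.norm_sub_of_adj v w hvw] at h1
  positivity

theorem inner_midpoint (h : IsInscribedEquilateral P c r l) {v w : E3} (hvw : (graph P).Adj v w) :
    inner ℝ (v - c) (midpoint ℝ v w - c) = r ^ 2 - l ^ 2 / 4 := by
  rw [inner_midpoint_sub, h.inner_self (h.polyhedron.left_mem_vertices_of_adj hvw),
    h.inner_adj hvw]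
  ring

/-- The center lies strictly on the inner side of the planes through the edge midpoints. -/
theorem midradius_sq_pos (h : IsInscribedEquilateral P c r l) : 0 < r ^ 2 - l ^ 2 / 4 := by
  obtain ⟨v, w, hvw⟩ := h.exists_adj
  have hv := h.inner_midpoint hvw
  have hw := h.inner_midpoint hvw.symm
  rw [midpoint_comm] at hw
  have hm : inner ℝ (midpoint ℝ v w - c) (midpoint ℝ v w - c) = r ^ 2 - l ^ 2 / 4 := by
    rw [inner_midpoint_sub, real_inner_comm, hv, real_inner_comm, hw]
    ring
  rw [← hm, real_inner_self_eq_norm_sq]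
  -- The quantity is the squared distance from the center to an edge midpoint, and an edge lies in a
  -- supporting plane that misses the center.
  have : midpoint ℝ v w ≠ c := by
    intro hc
    obtain ⟨g, b, hb, he⟩ := exists_inner_of_isExposed hvw.1 hvw.2.1
    have hF : {x ∈ P | inner ℝ g x = b} ∈ faces P 1 := he ▸ hvw
    have hlt := h.inner_center_lt g b (ne_zero_of_face h.dim_eq hF (by norm_num)) hb
    have hmem : midpoint ℝ v w ∈ {x ∈ P | inner ℝ g x = b} := by
      rw [← he]
      exact midpoint_mem_segment v w
    rw [← hc] at hlt
    exact hlt.ne hmem.2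
  have := norm_pos_iff.2 (sub_ne_zero.2 this)
  positivity

theorem inner_convexHull_adj (h : IsInscribedEquilateral P c r l) {v p : E3}
    (hp : p ∈ convexHull ℝ {w | (graph P).Adj v w}) :
    inner ℝ (v - c) (p - c) = r ^ 2 - l ^ 2 / 2 :=
  convexHull_min (fun _ hw => h.inner_adj hw) (convex_eq_inner_sub (v - c) c _) hp

theorem convexHull_adj_subset (h : IsInscribedEquilateral P c r l) {v : E3} :
    convexHull ℝ {w | (graph P).Adj v w} ⊆ P :=
  convexHull_min (fun _ hw => vertices_subset (h.polyhedron.right_mem_vertices_of_adj hw))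
    h.polyhedron.convex

/-- The parameter `t` measures depth below `v`: the truncating plane is at `t = 1 / 2` and the plane
of the neighbours at `t = 1`. -/
theorem exists_cone (h : IsInscribedEquilateral P c r l) {v x : E3} (hv : v ∈ vertices P)
    (hx : x ∈ P) (hxv : x ≠ v) :
    ∃ t > (0 : ℝ), ∃ p ∈ convexHull ℝ {w | (graph P).Adj v w}, x = v + t • (p - v) ∧
      inner ℝ (v - c) (x - c) = r ^ 2 - t * (l ^ 2 / 2) := by
  obtain ⟨t, ht, p, hp, rfl⟩ := h.polyhedron.mem_cone_of_mem hv hx hxv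
  refine ⟨t, ht, p, hp, rfl, ?_⟩
  have e : v + t • (p - v) - c = (v - c) + t • ((p - c) - (v - c)) := by module
  rw [e, inner_add_right, inner_smul_right, inner_sub_right _ (p - c), h.inner_self hv,
    h.inner_convexHull_adj hp]
  ring

theorem inner_le_of_ne (h : IsInscribedEquilateral P c r l) {v w : E3} (hv : v ∈ vertices P)
    (hw : w ∈ vertices P) (hvw : w ≠ v) : inner ℝ (v - c) (w - c) ≤ r ^ 2 - l ^ 2 / 2 := by
  obtain ⟨t, ht, p, hp, hwp, hi⟩ := h.exists_cone hv (vertices_subset hw) hvw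
  -- For `t < 1` the vertex `w` would be interior to the segment from `v` to the point `p` of `P`.
  have ht1 : 1 ≤ t := by
    by_contra! hlt
    have hmem : w ∈ openSegment ℝ v p := ⟨1 - t, t, by linarith, ht, by ring, by rw [hwp]; module⟩
    have := left_mem_minFace_of_mem_openSegment (vertices_subset hv)
      (h.convexHull_adj_subset hp) hmem
    rw [(h.polyhedron.mem_vertices_iff.1 hw).2] at this
    exact hvw (Set.mem_singleton_iff.1 this).symm
  have := h.length_sq_pos
  rw [hi]
  nlinarith

/-- Both ends of the edge differ from `v`, hence lie at or below the plane of the neighbours of `v`,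
which is strictly below the truncating plane. -/
theorem inner_edgeMidpoints_lt (h : IsInscribedEquilateral P c r l) {v m : E3}
    (hv : v ∈ vertices P) (hm : m ∈ edgeMidpoints P) (hvm : v ∉ minFace P m) :
    inner ℝ (v - c) (m - c) < r ^ 2 - l ^ 2 / 4 := by
  obtain ⟨a, b, hab, rfl⟩ := hm
  rw [h.polyhedron.minFace_midpoint hab] at hvm
  have ha := h.inner_le_of_ne hv (h.polyhedron.left_mem_vertices_of_adj hab)
    (fun e => hvm (e ▸ left_mem_segment ℝ a b))
  have hb := h.inner_le_of_ne hv (h.polyhedron.right_mem_vertices_of_adj hab)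
    (fun e => hvm (e ▸ right_mem_segment ℝ a b))
  have := h.length_sq_pos
  rw [inner_midpoint_sub]
  linarith

theorem inner_edgeMidpoints_eq (h : IsInscribedEquilateral P c r l) {v m : E3}
    (hv : v ∈ vertices P) (hm : m ∈ edgeMidpoints P) (hvm : v ∈ minFace P m) :
    inner ℝ (v - c) (m - c) = r ^ 2 - l ^ 2 / 4 := by
  obtain ⟨a, b, hab, rfl⟩ := hm
  rw [h.polyhedron.minFace_midpoint hab] at hvm
  rcases h.polyhedron.eq_or_eq_of_mem_edge hab hv hvm with rfl | rfl
  · exact h.inner_midpoint hab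
  · rw [midpoint_comm]
    exact h.inner_midpoint hab.symm

theorem inner_edgeMidpoints_le (h : IsInscribedEquilateral P c r l) {v m : E3}
    (hv : v ∈ vertices P) (hm : m ∈ edgeMidpoints P) :
    inner ℝ (v - c) (m - c) ≤ r ^ 2 - l ^ 2 / 4 := by
  by_cases hvm : v ∈ minFace P m
  · exact (h.inner_edgeMidpoints_eq hv hm hvm).le
  · exact (h.inner_edgeMidpoints_lt hv hm hvm).le

/-- The rectification is the truncation by the planes through the midpoints of the edges at
each vertex. -/
theorem rectify_eq (h : IsInscribedEquilateral P c r l) :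
    rectify P = {x ∈ P | ∀ v ∈ vertices P, inner ℝ (v - c) (x - c) ≤ r ^ 2 - l ^ 2 / 4} := by
  have hP := h.polyhedron
  refine Set.Subset.antisymm (fun x hx => ⟨hP.rectify_subset hx, fun v hv => ?_⟩) ?_
  · exact convexHull_min (fun m hm => h.inner_edgeMidpoints_le hv hm)
      (convex_inner_sub_le (v - c) c _) hx
  · rintro x ⟨hx, hxv⟩
    by_contra hxR
    have hfin : (edgeMidpoints P).Finite := hP.finite_edgeMidpoints
    -- Separate `x` from the midpoints and take `v` maximal for the functional `g`. Then `x = v + t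
    -- • (p - v)` with `t ≥ 1 / 2` and `g` does not increase from `v` to `p`, so `g` at `x` is at
    -- most its value at the midpoint of `v` and `p`, which is at most `u`.
    obtain ⟨f, u, hfu, hux⟩ := geometric_hahn_banach_closed_point (convex_convexHull ℝ _)
      (hfin.isClosed_convexHull ℝ) hxR
    set g := (InnerProductSpace.toDual ℝ E3).symm f
    have hfg : ∀ y, f y = inner ℝ g y := fun y => (InnerProductSpace.toDual_symm_apply).symm
    simp only [hfg] at hfu hux
    obtain ⟨v, hv, hmax⟩ := hP.exists_vertex_max ⟨x, hx⟩ g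
    have hl := h.length_sq_pos
    have hxne : x ≠ v := by
      rintro rfl
      have := hxv x hv
      rw [h.inner_self hv] at this
      linarith
    obtain ⟨t, ht, p, hp, rfl, hi⟩ := h.exists_cone hv hx hxne
    have ht2 : 1 / 2 ≤ t := by
      have := hxv v hv
      rw [hi] at this
      by_contra! hlt
      nlinarith
    have hpg : inner ℝ g p ≤ 2 * u - inner ℝ g v := by
      refine convexHull_min (fun w hw => ?_) (convex_inner_le g _) hp
      have h1 := hfu _ (subset_convexHull ℝ _ ⟨v, w, hw, rfl⟩)
      have h2 := inner_midpoint_sub g v w 0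
      simp only [sub_zero] at h2
      rw [h2] at h1
      change inner ℝ g w ≤ _
      linarith
    have hpv := hmax p (h.convexHull_adj_subset hp)
    rw [inner_add_right, inner_smul_right, inner_sub_right] at hux
    nlinarith

theorem midpoint_mem_vertexFigure {v p : E3}
    (hp : p ∈ convexHull ℝ {w | (graph P).Adj v w}) : midpoint ℝ v p ∈ vertexFigure P v := by
  have hmap : ∀ x, AffineMap.homothety v (1 / 2 : ℝ) x = midpoint ℝ v x := fun x => by
    rw [AffineMap.homothety_apply, midpoint_eq_smul_add, invOf_eq_inv, vsub_eq_sub, vadd_eq_add]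
    module
  have hconv : Convex ℝ (AffineMap.homothety v (1 / 2 : ℝ) ⁻¹' vertexFigure P v) :=
    (convex_convexHull ℝ _).affine_preimage _
  have := convexHull_min (fun w hw => ?_) hconv hp
  · rw [← hmap]
    exact this
  · rw [Set.mem_preimage, hmap]
    exact subset_convexHull ℝ _ ⟨w, hw, rfl⟩

theorem vertexFigure_subset_rectify {v : E3} : vertexFigure P v ⊆ rectify P :=
  convexHull_mono fun _ ⟨w, hw, hm⟩ => ⟨v, w, hw, hm⟩

/-- The cone cut off at `v` is the part of the polyhedron beyond the truncating plane. -/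
theorem vertexCone_eq (h : IsInscribedEquilateral P c r l) {v : E3} (hv : v ∈ vertices P) :
    vertexCone P v = {x ∈ P | r ^ 2 - l ^ 2 / 4 ≤ inner ℝ (v - c) (x - c)} := by
  have hl := h.length_sq_pos
  have hP := h.polyhedron
  refine Set.Subset.antisymm ?_ ?_
  · refine convexHull_min (Set.union_subset (fun m hm => ?_) ?_)
      (hP.convex.inter (convex_le_inner_sub (v - c) c _))
    · refine ⟨hP.rectify_subset (vertexFigure_subset_rectify hm), ?_⟩
      refine convexHull_min ?_ (convex_le_inner_sub (v - c) c _) hm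
      rintro _ ⟨w, hw, rfl⟩
      exact (h.inner_midpoint hw).ge
    · rintro _ rfl
      refine ⟨vertices_subset hv, ?_⟩
      rw [h.inner_self hv]
      linarith
  · rintro x ⟨hx, hxt⟩
    have hvc : v ∈ vertexCone P v := subset_convexHull ℝ _ (Or.inr rfl)
    rcases eq_or_ne x v with rfl | hxv
    · exact hvc
    obtain ⟨t, ht, p, hp, rfl, hi⟩ := h.exists_cone hv hx hxv
    -- Depth at most `1 / 2` puts `x` on the segment from `v` to the midpoint of `v` and `p`, a
    -- point of the vertex figure.
    have ht2 : 2 * t ≤ 1 := by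
      rw [hi] at hxt
      by_contra! hlt
      nlinarith
    have hm : midpoint ℝ v p ∈ vertexCone P v :=
      subset_convexHull ℝ _ (Or.inl (midpoint_mem_vertexFigure hp))
    have hcomb := convex_convexHull ℝ (vertexFigure P v ∪ {v}) hvc hm (a := 1 - 2 * t)
      (b := 2 * t) (by linarith) (by linarith) (by ring)
    have he : v + t • (p - v) = (1 - 2 * t) • v + (2 * t) • midpoint ℝ v p := by
      rw [midpoint_eq_smul_add, invOf_eq_inv]
      module
    rw [he]
    exact hcomb

/-- The vertex figure at `v` lies in the rectification, and `v` itself is on the inner side of the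
plane at `w`. Hence cones at different vertices overlap at most in their bounding planes. -/
theorem inner_le_of_mem_vertexCone (h : IsInscribedEquilateral P c r l) {v w x : E3}
    (hv : v ∈ vertices P) (hw : w ∈ vertices P) (hvw : v ≠ w) (hx : x ∈ vertexCone P v) :
    inner ℝ (w - c) (x - c) ≤ r ^ 2 - l ^ 2 / 4 := by
  refine convexHull_min (Set.union_subset (fun m hm => ?_) ?_)
    (convex_inner_sub_le (w - c) c _) hx
  · have := vertexFigure_subset_rectify hm
    rw [h.rectify_eq] at this
    exact this.2 w hw
  · rintro _ rfl
    have := h.inner_le_of_ne hw hv hvw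
    have := h.length_sq_pos
    change inner ℝ _ _ ≤ _
    linarith

theorem sub_center_ne_zero (h : IsInscribedEquilateral P c r l) {v : E3} (hv : v ∈ vertices P) :
    v - c ≠ 0 := by
  intro h0
  have h1 := h.inner_self hv
  rw [h0, inner_zero_left] at h1
  have := h.midradius_sq_pos
  have := h.length_sq_pos
  linarith

end IsInscribedEquilateral

/-! ### Volume of the rectification. -/

theorem volume_hyperplane {g c : E3} (hg : g ≠ 0) (k : ℝ) :
    MeasureTheory.volume {x : E3 | inner ℝ g (x - c) = k} = 0 := by
  rcases Set.eq_empty_or_nonempty {x : E3 | inner ℝ g (x - c) = k} with he | ⟨p, hp⟩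
  · rw [he, MeasureTheory.measure_empty]
  have hs : {x : E3 | inner ℝ g (x - c) = k} =
      (AffineSubspace.mk' p (LinearMap.ker (innerₛₗ ℝ g)) : Set E3) := by
    ext x
    have hp' : inner ℝ g (p - c) = k := hp
    rw [SetLike.mem_coe, AffineSubspace.mem_mk', LinearMap.mem_ker, innerₛₗ_apply_apply,
      vsub_eq_sub, ← sub_sub_sub_cancel_right x p c, inner_sub_right, hp', sub_eq_zero]
    rfl
  rw [hs]
  refine MeasureTheory.Measure.addHaar_affineSubspace _ _ fun htop => hg ?_
  have : p + g ∈ AffineSubspace.mk' p (LinearMap.ker (innerₛₗ ℝ g)) := htop ▸ AffineSubspace.mem_top ℝ E3 _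
  simpa using this

namespace IsInscribedEquilateral

variable {P : Set E3} {c : E3} {r l : ℝ}

theorem vol_rectify (h : IsInscribedEquilateral P c r l) :
    vol (rectify P) = vol P - ∑ᶠ v ∈ vertices P, vol (vertexCone P v) := by
  classical
  have hP := h.polyhedron
  have hfin := hP.finite_vertices
  have hPm : MeasurableSet P := hP.1.measurableSet
  have hPv : MeasureTheory.volume P ≠ ⊤ := hP.1.measure_lt_top.ne
  have hcont : ∀ v : E3, Continuous fun x => inner ℝ (v - c) (x - c) := fun v => by fun_prop
  set t := r ^ 2 - l ^ 2 / 4 with ht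
  -- The strict inequality makes these caps disjoint from each other and from the rectification;
  -- each differs from its cone only by a part of a plane.
  let C : E3 → Set E3 := fun v => {x ∈ P | t < inner ℝ (v - c) (x - c)}
  have hCm : ∀ v, MeasurableSet (C v) := fun v =>
    hPm.inter (measurableSet_lt measurable_const (hcont v).measurable)
  have hCsub : ∀ v ∈ vertices P, C v ⊆ vertexCone P v := fun v hv x hx => by
    rw [h.vertexCone_eq hv]
    exact ⟨hx.1, hx.2.le⟩
  have hCvol : ∀ v ∈ vertices P, vol (vertexCone P v) = vol (C v) := fun v hv => by
    refine congrArg ENNReal.toReal (le_antisymm ?_ (MeasureTheory.measure_mono (hCsub v hv)))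
    have hsub : vertexCone P v ⊆ C v ∪ {x | inner ℝ (v - c) (x - c) = t} := fun x hx => by
      rw [h.vertexCone_eq hv] at hx
      rcases hx.2.eq_or_lt with he | hlt
      · exact Or.inr he.symm
      · exact Or.inl ⟨hx.1, hlt⟩
    refine (MeasureTheory.measure_mono hsub).trans ((MeasureTheory.measure_union_le _ _).trans ?_)
    rw [volume_hyperplane (h.sub_center_ne_zero hv), add_zero]
  have hdisj : Set.PairwiseDisjoint (hfin.toFinset : Set E3) C := by
    intro v hv w hw hvw
    simp only [Set.Finite.coe_toFinset] at hv hw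
    refine Set.disjoint_left.2 fun x hx hx' => ?_
    exact hx'.2.not_ge (h.inner_le_of_mem_vertexCone hv hw hvw (hCsub v hv hx))
  have hdec : P = rectify P ∪ ⋃ v ∈ hfin.toFinset, C v := by
    refine Set.Subset.antisymm (fun x hx => ?_) (Set.union_subset hP.rectify_subset
      (Set.iUnion₂_subset fun v _ x hx => hx.1))
    by_cases hxR : ∀ v ∈ vertices P, inner ℝ (v - c) (x - c) ≤ t
    · left
      rw [h.rectify_eq]
      exact ⟨hx, hxR⟩
    · push Not at hxR
      obtain ⟨v, hv, hvx⟩ := hxR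
      exact Or.inr (Set.mem_iUnion₂.2 ⟨v, by simpa using hv, hx, hvx⟩)
  have hdisj' : Disjoint (rectify P) (⋃ v ∈ hfin.toFinset, C v) := by
    rw [Set.disjoint_left]
    intro x hx hx'
    obtain ⟨v, hv, hvx⟩ := Set.mem_iUnion₂.1 hx'
    rw [h.rectify_eq] at hx
    exact hvx.2.not_ge (hx.2 v (by simpa using hv))
  have hvol : vol P = vol (rectify P) + ∑ v ∈ hfin.toFinset, vol (C v) := by
    have hU : MeasureTheory.volume (⋃ v ∈ hfin.toFinset, C v) ≠ ⊤ :=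
      ne_top_of_le_ne_top hPv (MeasureTheory.measure_mono (Set.iUnion₂_subset fun v _ x hx => hx.1))
    have hR : MeasureTheory.volume (rectify P) ≠ ⊤ :=
      ne_top_of_le_ne_top hPv (MeasureTheory.measure_mono hP.rectify_subset)
    have h1 := MeasureTheory.measureReal_union hdisj'
      (hfin.toFinset.measurableSet_biUnion fun v _ => hCm v) hR hU
    rw [← hdec, MeasureTheory.measureReal_biUnion_finset hdisj (fun v _ => hCm v)
      fun v _ => ne_top_of_le_ne_top hPv (MeasureTheory.measure_mono fun x hx => hx.1)] at h1
    exact h1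
  rw [finsum_mem_eq_finite_toFinset_sum _ hfin, hvol,
    Finset.sum_congr rfl fun v hv => hCvol v (by simpa using hv)]
  ring

end IsInscribedEquilateral

/-! ### Face numbers of the rectification. -/

/-- Two edges with two common vertices agree. -/
theorem IsConvexPolyhedron.edge_eq_of_vertices {P e e' : Set E3} (hP : IsConvexPolyhedron P)
    (he : e ∈ faces P 1) (he' : e' ∈ faces P 1) {v w : E3} (hv : v ∈ vertices P)
    (hw : w ∈ vertices P) (hvw : v ≠ w) (hve : v ∈ e) (hwe : w ∈ e) (hve' : v ∈ e')
    (hwe' : w ∈ e') : e = e' := by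
  obtain ⟨a, ha, rfl⟩ := hP.exists_adj_of_mem_edge he hv hve
  obtain ⟨b, hb, rfl⟩ := hP.exists_adj_of_mem_edge he' hv hve'
  obtain rfl := (hP.eq_or_eq_of_mem_edge ha hw hwe).resolve_left hvw.symm
  obtain rfl := (hP.eq_or_eq_of_mem_edge hb hw hwe').resolve_left hvw.symm
  rfl

/-- Two edges contained in two common facets agree. -/
theorem IsConvexPolyhedron.edge_eq_of_facets {P e e' F G : Set E3} (hP : IsConvexPolyhedron P)
    (he : e ∈ faces P 1) (he' : e' ∈ faces P 1) (hF : F ∈ faces P 2) (hG : G ∈ faces P 2)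
    (hFG : F ≠ G) (heF : e ⊆ F) (heG : e ⊆ G) (heF' : e' ⊆ F) (heG' : e' ⊆ G) : e = e' := by
  have hne : (F ∩ G).Nonempty := he.1.mono (Set.subset_inter heF heG)
  have hex : IsExposed ℝ P (F ∩ G) := hF.2.1.inter hG.2.1
  have h1 : Module.finrank ℝ (vectorSpan ℝ (F ∩ G)) ≤ 2 :=
    (Submodule.finrank_mono (vectorSpan_mono ℝ Set.inter_subset_left)).trans hF.2.2.le
  have h2 : 1 ≤ Module.finrank ℝ (vectorSpan ℝ (F ∩ G)) :=
    he.2.2.ge.trans (Submodule.finrank_mono (vectorSpan_mono ℝ (Set.subset_inter heF heG)))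
  have h3 : Module.finrank ℝ (vectorSpan ℝ (F ∩ G)) ≠ 2 := fun h => hFG
    ((hP.face_eq_of_subset ⟨hne, hex, h⟩ hF Set.inter_subset_left).symm.trans
      (hP.face_eq_of_subset ⟨hne, hex, h⟩ hG Set.inter_subset_right))
  have h4 : F ∩ G ∈ faces P 1 := ⟨hne, hex, by omega⟩
  exact (hP.face_eq_of_subset he h4 (Set.subset_inter heF heG)).trans
    (hP.face_eq_of_subset he' h4 (Set.subset_inter heF' heG')).symm

/-- The incident pairs of a vertex and a facet. -/
def vertexFacetFlags (P : Set E3) : Set (E3 × Set E3) :=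
  {q | q.1 ∈ vertices P ∧ q.2 ∈ faces P 2 ∧ q.1 ∈ q.2}

/-- Double counting against edges between the two: each flag has two such edges, and each edge has
two ends times two facets, hence four flags. -/
theorem IsConvexPolyhedron.ncard_vertexFacetFlags {P : Set E3} (hP : IsConvexPolyhedron P)
    (hd : Module.finrank ℝ (vectorSpan ℝ P) = 3) :
    (vertexFacetFlags P).ncard = 2 * fNumber P 1 := by
  have hfin : (vertexFacetFlags P).Finite :=
    (hP.finite_vertices.prod (hP.finite_faces 2)).subset fun q hq => ⟨hq.1, hq.2.1⟩
  have h := ncard_mul_eq_ncard_mul hfin (hP.finite_faces 1) (fun q e => q.1 ∈ e ∧ e ⊆ q.2)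
    (m := 2) (n := 4) (fun q hq => hP.ncard_edges_of_flag hq.2.1 hq.1 hq.2.2) fun e he => by
      have : {q ∈ vertexFacetFlags P | q.1 ∈ e ∧ e ⊆ q.2} =
          {v ∈ vertices P | v ∈ e} ×ˢ {F ∈ faces P 2 | e ⊆ F} := by
        ext q
        constructor
        · rintro ⟨⟨h1, h2, h3⟩, h4, h5⟩
          exact ⟨⟨h1, h4⟩, h2, h5⟩
        · rintro ⟨⟨h1, h4⟩, h2, h5⟩
          exact ⟨⟨h1, h2, h5 h4⟩, h4, h5⟩
      rw [this, Set.ncard_prod, hP.ncard_vertices_of_edge he, hP.ncard_facets_of_edge hd he]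
  rw [fNumber]
  omega

theorem vertices_subset_extremePoints {P : Set E3} : vertices P ⊆ P.extremePoints ℝ := fun _ hv =>
  exposedPoints_subset_extremePoints (mem_exposedPoints_iff_exposed_singleton.2 hv.2.1)

theorem vertices_rectify_subset {P : Set E3} : vertices (rectify P) ⊆ edgeMidpoints P :=
  vertices_subset_extremePoints.trans extremePoints_convexHull_subset

theorem finrank_vectorSpan_segment {a b : E3} (hab : a ≠ b) :
    Module.finrank ℝ (vectorSpan ℝ (segment ℝ a b)) = 1 := by
  rw [← convexHull_pair, ← direction_affineSpan, affineSpan_convexHull, direction_affineSpan,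
    vectorSpan_pair_rev, finrank_span_singleton]
  exact sub_ne_zero.2 hab.symm

namespace IsInscribedEquilateral

variable {P : Set E3} {c : E3} {r l : ℝ}

/-- The rectification as an intersection of half-spaces, all containing the center in their
interior. -/
theorem exists_constraints_rectify (h : IsInscribedEquilateral P c r l) :
    ∃ H : Set (E3 × ℝ), H.Finite ∧ (∀ q ∈ H, q.1 ≠ 0) ∧
      rectify P = {x | ∀ q ∈ H, inner ℝ q.1 x ≤ q.2} ∧ (∀ q ∈ H, inner ℝ q.1 c < q.2) ∧
      ∀ q ∈ H, (∀ y ∈ P, inner ℝ q.1 y ≤ q.2) ∨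
        ∃ v ∈ vertices P, ∀ x, inner ℝ q.1 x = q.2 ↔
          inner ℝ (v - c) (x - c) = r ^ 2 - l ^ 2 / 4 := by
  obtain ⟨hc, H, hf, h0, hPH⟩ := h.polyhedron
  have hHP : ∀ q ∈ H, ∀ y ∈ P, inner ℝ q.1 y ≤ q.2 := fun q hq y hy => by
    rw [hPH] at hy
    exact hy q hq
  let N : E3 → E3 × ℝ := fun v => (v - c, r ^ 2 - l ^ 2 / 4 + inner ℝ (v - c) c)
  refine ⟨H ∪ N '' vertices P, hf.union (h.polyhedron.finite_vertices.image N), ?_, ?_, ?_, ?_⟩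
  · rintro q (hq | ⟨v, hv, rfl⟩)
    · exact h0 q hq
    · exact h.sub_center_ne_zero hv
  · rw [h.rectify_eq]
    ext x
    constructor
    · rintro ⟨hx, hx'⟩ q (hq | ⟨v, hv, rfl⟩)
      · exact hHP q hq x hx
      · have := hx' v hv
        rw [inner_sub_right] at this
        change inner ℝ (v - c) x ≤ r ^ 2 - l ^ 2 / 4 + inner ℝ (v - c) c
        linarith
    · intro hx
      refine ⟨?_, fun v hv => ?_⟩
      · rw [hPH]
        exact fun q hq => hx q (Or.inl hq)
      · have : inner ℝ (v - c) x ≤ r ^ 2 - l ^ 2 / 4 + inner ℝ (v - c) c :=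
          hx _ (Or.inr ⟨v, hv, rfl⟩)
        rw [inner_sub_right]
        linarith
  · rintro q (hq | ⟨v, hv, rfl⟩)
    · exact h.inner_center_lt q.1 q.2 (h0 q hq) (hHP q hq)
    · have := h.midradius_sq_pos
      change inner ℝ (v - c) c < r ^ 2 - l ^ 2 / 4 + inner ℝ (v - c) c
      linarith
  · rintro q (hq | ⟨v, hv, rfl⟩)
    · exact Or.inl (hHP q hq)
    · refine Or.inr ⟨v, hv, fun x => ?_⟩
      change inner ℝ (v - c) x = r ^ 2 - l ^ 2 / 4 + inner ℝ (v - c) c ↔ _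
      rw [inner_sub_right, sub_eq_iff_eq_add]

theorem isConvexPolyhedron_rectify (h : IsInscribedEquilateral P c r l) :
    IsConvexPolyhedron (rectify P) := by
  obtain ⟨H, hf, h0, hR, -⟩ := h.exists_constraints_rectify
  exact ⟨h.polyhedron.finite_edgeMidpoints.isCompact_convexHull ℝ, H, hf, h0, hR⟩

theorem finrank_rectify (h : IsInscribedEquilateral P c r l) :
    Module.finrank ℝ (vectorSpan ℝ (rectify P)) = 3 := by
  obtain ⟨H, hf, -, hR, hc, -⟩ := h.exists_constraints_rectify
  exact finrank_of_strict hf hR hc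

theorem isExposed_vertexFace (h : IsInscribedEquilateral P c r l) {v : E3} (hv : v ∈ vertices P) :
    IsExposed ℝ (rectify P)
      {x ∈ rectify P | inner ℝ (v - c) (x - c) = r ^ 2 - l ^ 2 / 4} := by
  have := isExposed_of_inner (P := rectify P) (g := v - c)
    (b := r ^ 2 - l ^ 2 / 4 + inner ℝ (v - c) c) fun y hy => by
      rw [h.rectify_eq] at hy
      have := hy.2 v hv
      rw [inner_sub_right] at this
      linarith
  simpa only [inner_sub_right, sub_eq_iff_eq_add] using this

/-- Every facet of the rectification is a truncated vertex or lies in a facet. -/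
theorem facet_rectify (h : IsInscribedEquilateral P c r l) {K : Set E3}
    (hK : K ∈ faces (rectify P) 2) :
    (∃ v ∈ vertices P, K = {x ∈ rectify P | inner ℝ (v - c) (x - c) = r ^ 2 - l ^ 2 / 4}) ∨
      ∃ F ∈ faces P 2, K = rectify P ∩ F := by
  obtain ⟨H, hf, h0, hR, hc, hH⟩ := h.exists_constraints_rectify
  obtain ⟨q, hq, rfl⟩ := exists_constraint_of_facet h.isConvexPolyhedron_rectify hf h0 hR
    h.finrank_rectify hK
  rcases hH q hq with hqP | ⟨v, hv, hvq⟩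
  · refine Or.inr ⟨{x ∈ P | inner ℝ q.1 x = q.2}, ⟨?_, isExposed_of_inner hqP, ?_⟩, ?_⟩
    · obtain ⟨x, hx, hx'⟩ := hK.1
      exact ⟨x, h.polyhedron.rectify_subset hx, hx'⟩
    · refine le_antisymm (finrank_vectorSpan_le_two (h0 q hq) fun y hy => hy.2) ?_
      rw [← hK.2.2]
      exact Submodule.finrank_mono (vectorSpan_mono ℝ fun x hx =>
        ⟨h.polyhedron.rectify_subset hx.1, hx.2⟩)
    · ext x
      exact ⟨fun hx => ⟨hx.1, h.polyhedron.rectify_subset hx.1, hx.2⟩, fun hx => ⟨hx.1, hx.2.2⟩⟩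
  · refine Or.inl ⟨v, hv, ?_⟩
    ext x
    exact and_congr_right fun _ => hvq x

theorem mem_minFace_of_inner_eq (h : IsInscribedEquilateral P c r l) {v m : E3}
    (hv : v ∈ vertices P) (hm : m ∈ edgeMidpoints P)
    (hi : inner ℝ (v - c) (m - c) = r ^ 2 - l ^ 2 / 4) : v ∈ minFace P m := by
  by_contra hvm
  exact (h.inner_edgeMidpoints_lt hv hm hvm).ne hi

theorem vertices_rectify (h : IsInscribedEquilateral P c r l) :
    vertices (rectify P) = edgeMidpoints P := by
  have hP := h.polyhedron
  have hRp := h.isConvexPolyhedron_rectify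
  refine vertices_rectify_subset.antisymm fun m hm => ?_
  obtain ⟨a, b, hab, hmab⟩ := id hm
  have ha := hP.left_mem_vertices_of_adj hab
  have hb := hP.right_mem_vertices_of_adj hab
  have hmR : m ∈ rectify P := subset_convexHull ℝ _ hm
  have hea : a ∈ minFace P m := by
    rw [hmab, hP.minFace_midpoint hab]
    exact left_mem_segment ℝ a b
  have heb : b ∈ minFace P m := by
    rw [hmab, hP.minFace_midpoint hab]
    exact right_mem_segment ℝ a b
  -- The truncating planes at the two ends of the edge expose `m`: any midpoint on both belongs to
  -- an edge through both `a` and `b`.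
  set G := {x ∈ rectify P | inner ℝ (a - c) (x - c) = r ^ 2 - l ^ 2 / 4} ∩
    {x ∈ rectify P | inner ℝ (b - c) (x - c) = r ^ 2 - l ^ 2 / 4}
  have hG : IsExposed ℝ (rectify P) G := (h.isExposed_vertexFace ha).inter (h.isExposed_vertexFace hb)
  have hmG : m ∈ G := ⟨⟨hmR, h.inner_edgeMidpoints_eq ha hm hea⟩,
    hmR, h.inner_edgeMidpoints_eq hb hm heb⟩
  have hsub : G ⊆ {m} := by
    refine (hRp.of_isExposed ⟨m, hmG⟩ hG).subset_singleton_of_vertices fun m' hm' => ?_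
    -- The dimension of `G` is not known yet and is left as its own value; only the description of
    -- the vertices of a face is needed.
    have hG' : G ∈ faces (rectify P) _ := ⟨⟨m, hmG⟩, hG, rfl⟩
    rw [hRp.vertices_of_face hG'] at hm'
    obtain ⟨hm'V, ⟨-, h1⟩, -, h2⟩ := hm'
    have hm'M := vertices_rectify_subset hm'V
    refine hP.bijOn_edgeMidpoints.injOn hm'M hm ?_
    exact hP.edge_eq_of_vertices (hP.minFace_mem_of_mem_edgeMidpoints hm'M).2
      (hP.minFace_mem_of_mem_edgeMidpoints hm).2 ha hb hab.ne (h.mem_minFace_of_inner_eq ha hm'M h1)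
      (h.mem_minFace_of_inner_eq hb hm'M h2) hea heb
  have hGm : G = {m} := hsub.antisymm (Set.singleton_subset_iff.2 hmG)
  rw [hGm] at hG
  exact ⟨Set.singleton_nonempty m, hG, by rw [vectorSpan_singleton, finrank_bot]⟩

theorem fNumber_zero_rectify (h : IsInscribedEquilateral P c r l) :
    fNumber (rectify P) 0 = fNumber P 1 := by
  rw [fNumber_zero, h.vertices_rectify]
  exact h.polyhedron.bijOn_edgeMidpoints.ncard_eq

/-- The edge of the rectification that corresponds to an incident vertex and facet. -/
def flagEdge (P : Set E3) (c : E3) (k : ℝ) (q : E3 × Set E3) : Set E3 :=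
  {x ∈ rectify P | inner ℝ (q.1 - c) (x - c) = k} ∩ (rectify P ∩ q.2)

theorem isExposed_inter_facet (h : IsInscribedEquilateral P c r l) {F : Set E3} {i : ℕ}
    (hF : F ∈ faces P i) : IsExposed ℝ (rectify P) (rectify P ∩ F) := by
  obtain ⟨g, b, hb, rfl⟩ := exists_inner_of_isExposed hF.1 hF.2.1
  convert isExposed_of_inner (P := rectify P) (g := g) (b := b)
    fun y hy => hb y (h.polyhedron.rectify_subset hy) using 1
  ext x
  exact ⟨fun hx => ⟨hx.1, hx.2.2⟩, fun hx => ⟨hx.1, h.polyhedron.rectify_subset hx.1, hx.2⟩⟩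

/-- The facet has exactly two edges at the vertex, and their midpoints are the only vertices of the
rectification on this face. -/
theorem exists_flagEdge_eq (h : IsInscribedEquilateral P c r l) {q : E3 × Set E3}
    (hq : q ∈ vertexFacetFlags P) :
    ∃ m ∈ edgeMidpoints P, ∃ m' ∈ edgeMidpoints P, m ≠ m' ∧
      m ∈ flagEdge P c (r ^ 2 - l ^ 2 / 4) q ∧ m' ∈ flagEdge P c (r ^ 2 - l ^ 2 / 4) q ∧
      flagEdge P c (r ^ 2 - l ^ 2 / 4) q ∈ faces (rectify P) 1 := by
  have hP := h.polyhedron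
  have hRp := h.isConvexPolyhedron_rectify
  obtain ⟨v, F⟩ := q
  obtain ⟨hv, hF, hvF⟩ := hq
  simp only at hv hF hvF
  obtain ⟨e, e', hee, hset⟩ := Set.ncard_eq_two.1 (hP.ncard_edges_of_flag hF hv hvF)
  have he : e ∈ {e ∈ faces P 1 | v ∈ e ∧ e ⊆ F} := hset ▸ Or.inl rfl
  have he' : e' ∈ {e ∈ faces P 1 | v ∈ e ∧ e ⊆ F} := hset ▸ Or.inr rfl
  obtain ⟨m, hm, rfl⟩ := hP.bijOn_edgeMidpoints.surjOn he.1
  obtain ⟨m', hm', rfl⟩ := hP.bijOn_edgeMidpoints.surjOn he'.1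
  have hmem : ∀ n ∈ edgeMidpoints P, v ∈ minFace P n → minFace P n ⊆ F →
      n ∈ flagEdge P c (r ^ 2 - l ^ 2 / 4) (v, F) := fun n hn h1 h2 => by
    have hnR : n ∈ rectify P := subset_convexHull ℝ _ hn
    exact ⟨⟨hnR, h.inner_edgeMidpoints_eq hv hn h1⟩, hnR,
      h2 (self_mem_minFace (hP.rectify_subset hnR))⟩
  have hmG := hmem m hm he.2.1 he.2.2
  have hmG' := hmem m' hm' he'.2.1 he'.2.2
  have hne : m ≠ m' := fun h' => hee (by rw [h'])
  have hex : IsExposed ℝ (rectify P) (flagEdge P c (r ^ 2 - l ^ 2 / 4) (v, F)) :=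
    (h.isExposed_vertexFace hv).inter (h.isExposed_inter_facet hF)
  refine ⟨m, hm, m', hm', hne, hmG, hmG', ⟨m, hmG⟩, hex, ?_⟩
  have hGp := hRp.of_isExposed ⟨m, hmG⟩ hex
  have hG : flagEdge P c (r ^ 2 - l ^ 2 / 4) (v, F) = segment ℝ m m' := by
    refine Set.Subset.antisymm ?_ (hGp.convex.segment_subset hmG hmG')
    rw [← hGp.convexHull_vertices, ← convexHull_pair]
    refine convexHull_mono fun n hn => ?_
    have hG' : flagEdge P c (r ^ 2 - l ^ 2 / 4) (v, F) ∈ faces (rectify P) _ :=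
      ⟨⟨m, hmG⟩, hex, rfl⟩
    rw [hRp.vertices_of_face hG'] at hn
    obtain ⟨hnV, ⟨-, hn1⟩, -, hn2⟩ := hn
    have hnM := vertices_rectify_subset hnV
    have : minFace P n ∈ {e ∈ faces P 1 | v ∈ e ∧ e ⊆ F} :=
      ⟨(hP.minFace_mem_of_mem_edgeMidpoints hnM).2, h.mem_minFace_of_inner_eq hv hnM hn1,
        minFace_subset_of_mem_faces hF hn2⟩
    rw [hset] at this
    exact this.imp (hP.bijOn_edgeMidpoints.injOn hnM hm) (hP.bijOn_edgeMidpoints.injOn hnM hm')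
  rw [hG]
  exact finrank_vectorSpan_segment hne

/-- The edges of the rectification correspond to the incident pairs of a vertex and a facet. -/
theorem bijOn_flagEdge (h : IsInscribedEquilateral P c r l) :
    Set.BijOn (flagEdge P c (r ^ 2 - l ^ 2 / 4)) (vertexFacetFlags P) (faces (rectify P) 1) := by
  have hP := h.polyhedron
  have hRp := h.isConvexPolyhedron_rectify
  have hvv : ∀ v ∈ vertices P, ∀ w ∈ vertices P, ∀ m ∈ edgeMidpoints P, ∀ m' ∈ edgeMidpoints P,
      m ≠ m' → inner ℝ (v - c) (m - c) = r ^ 2 - l ^ 2 / 4 →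
      inner ℝ (v - c) (m' - c) = r ^ 2 - l ^ 2 / 4 → inner ℝ (w - c) (m - c) = r ^ 2 - l ^ 2 / 4 →
      inner ℝ (w - c) (m' - c) = r ^ 2 - l ^ 2 / 4 → v = w := by
    intro v hv w hw m hm m' hm' hne h1 h2 h3 h4
    by_contra hvw
    exact hne (hP.bijOn_edgeMidpoints.injOn hm hm' (hP.edge_eq_of_vertices
      (hP.minFace_mem_of_mem_edgeMidpoints hm).2 (hP.minFace_mem_of_mem_edgeMidpoints hm').2
      hv hw hvw (h.mem_minFace_of_inner_eq hv hm h1) (h.mem_minFace_of_inner_eq hw hm h3)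
      (h.mem_minFace_of_inner_eq hv hm' h2) (h.mem_minFace_of_inner_eq hw hm' h4)))
  have hFF : ∀ F ∈ faces P 2, ∀ G ∈ faces P 2, ∀ m ∈ edgeMidpoints P, ∀ m' ∈ edgeMidpoints P,
      m ≠ m' → m ∈ F → m' ∈ F → m ∈ G → m' ∈ G → F = G := by
    intro F hF G hG m hm m' hm' hne h1 h2 h3 h4
    by_contra hFG
    exact hne (hP.bijOn_edgeMidpoints.injOn hm hm' (hP.edge_eq_of_facets
      (hP.minFace_mem_of_mem_edgeMidpoints hm).2 (hP.minFace_mem_of_mem_edgeMidpoints hm').2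
      hF hG hFG (minFace_subset_of_mem_faces hF h1) (minFace_subset_of_mem_faces hG h3)
      (minFace_subset_of_mem_faces hF h2) (minFace_subset_of_mem_faces hG h4)))
  refine ⟨fun q hq => ?_, ?_, ?_⟩
  · obtain ⟨-, -, -, -, -, -, -, hmem⟩ := h.exists_flagEdge_eq hq
    exact hmem
  · intro q hq q' hq' heq
    obtain ⟨m, hm, m', hm', hne, hmG, hmG', -⟩ := h.exists_flagEdge_eq hq
    have hmH := heq ▸ hmG
    have hmH' := heq ▸ hmG'
    exact Prod.ext
      (hvv _ hq.1 _ hq'.1 m hm m' hm' hne hmG.1.2 hmG'.1.2 hmH.1.2 hmH'.1.2)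
      (hFF _ hq.2.1 _ hq'.2.1 m hm m' hm' hne hmG.2.2 hmG'.2.2 hmH.2.2 hmH'.2.2)
  · intro G hG
    obtain ⟨m, m', hne, hGs, hmV, hmV', -⟩ := hRp.exists_edge_ends hG
    have hm := vertices_rectify_subset hmV
    have hm' := vertices_rectify_subset hmV'
    have hmG : m ∈ G := hGs ▸ left_mem_segment ℝ m m'
    have hmG' : m' ∈ G := hGs ▸ right_mem_segment ℝ m m'
    -- The two facets at an edge must be of different kinds: two distinct midpoints determine the
    -- vertex by `hvv` and the facet by `hFF`, so facets of one kind would coincide.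
    obtain ⟨K, L, hKL, hset⟩ := Set.ncard_eq_two.1 (hRp.ncard_facets_of_edge h.finrank_rectify hG)
    have hK : K ∈ {F ∈ faces (rectify P) 2 | G ⊆ F} := hset ▸ Or.inl rfl
    have hL : L ∈ {F ∈ faces (rectify P) 2 | G ⊆ F} := hset ▸ Or.inr rfl
    have mixed : ∀ v ∈ vertices P, ∀ F ∈ faces P 2,
        G ⊆ {x ∈ rectify P | inner ℝ (v - c) (x - c) = r ^ 2 - l ^ 2 / 4} → G ⊆ rectify P ∩ F →
        G ∈ flagEdge P c (r ^ 2 - l ^ 2 / 4) '' vertexFacetFlags P := by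
      intro v hv F hF h1 h2
      have hflag : (v, F) ∈ vertexFacetFlags P := ⟨hv, hF,
        minFace_subset_of_mem_faces hF (h2 hmG).2 (h.mem_minFace_of_inner_eq hv hm (h1 hmG).2)⟩
      obtain ⟨-, -, -, -, -, -, -, hmem⟩ := h.exists_flagEdge_eq hflag
      exact ⟨(v, F), hflag, (hRp.face_eq_of_subset hG hmem (Set.subset_inter h1 h2)).symm⟩
    obtain ⟨hK2, hGK⟩ := hK
    obtain ⟨hL2, hGL⟩ := hL
    rcases h.facet_rectify hK2 with ⟨v, hv, rfl⟩ | ⟨F, hF, rfl⟩ <;>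
    rcases h.facet_rectify hL2 with ⟨w, hw, rfl⟩ | ⟨F', hF', rfl⟩
    · refine absurd ?_ hKL
      rw [hvv v hv w hw m hm m' hm' hne (hGK hmG).2 (hGK hmG').2 (hGL hmG).2 (hGL hmG').2]
    · exact mixed v hv F' hF' hGK hGL
    · exact mixed w hw F hF hGL hGK
    · refine absurd ?_ hKL
      rw [hFF F hF F' hF' m hm m' hm' hne (hGK hmG).2 (hGK hmG').2 (hGL hmG).2 (hGL hmG').2]

theorem fNumber_one_rectify (h : IsInscribedEquilateral P c r l) :
    fNumber (rectify P) 1 = 2 * fNumber P 1 := by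
  rw [← h.polyhedron.ncard_vertexFacetFlags h.dim_eq]
  exact h.bijOn_flagEdge.ncard_eq.symm

theorem fNumber_two_rectify (h : IsInscribedEquilateral P c r l) :
    fNumber (rectify P) 2 = 2 + fNumber P 1 := by
  have := h.isConvexPolyhedron_rectify.euler h.finrank_rectify
  rw [h.fNumber_zero_rectify, h.fNumber_one_rectify] at this
  omega

end IsInscribedEquilateral

/-! ### Iteration along the rectification sequence. -/

theorem R_succ (k : ℕ) (P : Set E3) : R (k + 1) P = rectify (R k P) :=
  Function.iterate_succ_apply' rectify k P

theorem fNumber_one_R {P : Set E3} {k : ℕ} (hP : ∀ i < k, IsSemiregular (R i P)) :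
    fNumber (R k P) 1 = 2 ^ k * fNumber P 1 := by
  induction k with
  | zero => simp [R]
  | succ k ih =>
    obtain ⟨r, l, h⟩ := (hP k k.lt_succ_self).exists_isInscribedEquilateral
    rw [R_succ, h.fNumber_one_rectify, ih fun i hi => hP i (hi.trans k.lt_succ_self), pow_succ]
    ring

theorem vol_R {P : Set E3} {k : ℕ} (hP : ∀ i < k, IsSemiregular (R i P)) :
    vol (R k P) = vol P - ∑ N ∈ Finset.range k,
      ∑ᶠ v ∈ vertices (R N P), vol (vertexCone (R N P) v) := by
  induction k with
  | zero => simp [R]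
  | succ k ih =>
    obtain ⟨r, l, h⟩ := (hP k k.lt_succ_self).exists_isInscribedEquilateral
    rw [R_succ, h.vol_rectify, ih fun i hi => hP i (hi.trans k.lt_succ_self),
      Finset.sum_range_succ]
    ring

end Rectification
end

theorem theorem4 (P : Set Rectification.E3) (k : ℕ) (hk : 1 ≤ k)
    (hP : ∀ i < k, Rectification.IsSemiregular (Rectification.R i P)) :
    ((Rectification.fNumber (Rectification.R k P) 0,
      Rectification.fNumber (Rectification.R k P) 1,
      Rectification.fNumber (Rectification.R k P) 2) : ℕ × ℕ × ℕ) =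
      (2 ^ (k - 1) * Rectification.fNumber P 1,
       2 ^ k * Rectification.fNumber P 1,
       2 + 2 ^ (k - 1) * Rectification.fNumber P 1) ∧
    Rectification.vol (Rectification.R k P) =
      Rectification.vol P
        - ∑ᶠ v ∈ Rectification.vertices P, Rectification.vol (Rectification.vertexCone P v)
        - ∑ N ∈ Finset.Ico 1 k, ∑ᶠ v ∈ Rectification.vertices (Rectification.R N P),
            Rectification.vol (Rectification.vertexCone (Rectification.R N P) v) := by
  open Rectification in
  constructor
  · obtain ⟨n, rfl⟩ : ∃ n, k = n + 1 := ⟨k - 1, by omega⟩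
    -- The vertices and facets of the last term are counted by the edges of its predecessor `R n P`,
    -- hence the exponent `k - 1`.
    obtain ⟨r, l, h⟩ := (hP n n.lt_succ_self).exists_isInscribedEquilateral
    have h1 := fNumber_one_R fun i hi => hP i (Nat.lt_succ_of_lt hi)
    rw [fNumber_one_R hP, R_succ, h.fNumber_zero_rectify, h.fNumber_two_rectify, h1,
      Nat.add_sub_cancel]
  -- The term `N = 0` is split off; `R 0 P` is `P` by definition.
  · rw [vol_R hP, Finset.range_eq_Ico, Finset.sum_eq_sum_Ico_succ_bot (by omega : 0 < k), sub_sub]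
    rfl
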